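/- **Theorem 5.7.** Let $\mathcal A$ be a weakly idempotent complete exact category, i.e. an additive category with an exact structure in the sense of Quillen, in which every split epimorphism has a kernel. A cotorsion pair is a pair $(\mathcal X,\mathcal Y)$ of classes of objects with $\mathcal X=\{X \mid \operatorname{Ext}^1(X,Y)=0\ \forall\, Y\in\mathcal Y\}$ and $\mathcal Y=\{Y \mid \operatorname{Ext}^1(X,Y)=0\ \forall\, X\in\mathcal X\}$. It is complete if every object $M$ fits into admissible exact sequences $0\to Y\to X\to M\to 0$ and $0\to M\to Y'\to X'\to 0$ with $X,X'\in\mathcal X$ and $Y,Y'\in\mathcal Y$. It is hereditary if $\mathcal X$ is closed under kernels of deflations (between objects of $\mathcal X$) and $\mathcal Y$ is closed under cokernels of inflations (between objects of $\mathcal Y$). A class $\omega$ of objects is covariantly finite if for every object $M$ there is a morphism $M\to W$ with $W\in\omega$ through which every morphism from $M$ to an object of $\omega$ factors. Let $S^C$ be the class of hereditary complete cotorsion pairs $(\mathcal X,\mathcal Y)$ in $\mathcal A$ whose core $\omega=\mathcal X\cap\mathcal Y$ is covariantly finite. A (closed) model structure on $\mathcal A$ is a triple $(\mathrm{CoFib},\mathrm{Fib},\mathrm{Weq})$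 of classes of morphisms (cofibrations, fibrations, weak equivalences) satisfying the two-out-of-three axiom for $\mathrm{Weq}$, the retract axiom for all three classes, the lifting axiom, and the factorization axiom; no existence of limits or colimits is required. An object $X$ is cofibrant if $0\to X$ is in $\mathrm{CoFib}$, fibrant if $X\to 0$ is in $\mathrm{Fib}$, trivial if $0\to X$ is in $\mathrm{Weq}$, and trivially cofibrant if it is both trivial and cofibrant. A trivial cofibration is a morphism in $\mathrm{CoFib}\cap\mathrm{Weq}$. A model structure on $\mathcal A$ is weakly injective if $\mathrm{Fib}$ is precisely the class of deflations with fibrant kernel, each trivial cofibration is an inflation, and each object is cofibrant. Let $S^M$ be the class of weakly injective model structures on $\mathcal A$. For $(\mathcal X,\mathcal Y)\in S^C$ with $\omega=\mathcal X\cap\mathcal Y$ define: - $\mathrm{CoFib}^\omega$: the morphisms $f:A\to B$ such that $\operatorname{Hom}(f,W):\operatorname{Hom}(B,W)\to\operatorname{Hom}(A,W)$ is surjective for every $W\in\omega$; - $\mathrm{Fib}^\omega$: the deflations with kernel in $\mathcal Y$; - $\mathrm{Weq}^\omega$: the morphisms $f:A\to B$ for which there are $W\in\omega$ and $t:A\to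 W$ such that $\binom{f}{t}:A\to B\oplus W$ is an inflation with cokernel in $\mathcal X$. Then $\Phi:(\mathcal X,\mathcal Y)\mapsto(\mathrm{CoFib}^\omega,\mathrm{Fib}^\omega,\mathrm{Weq}^\omega)$ and $\Psi:(\mathrm{CoFib},\mathrm{Fib},\mathrm{Weq})\mapsto(\mathrm T\mathcal C,\mathcal F)$, where $\mathrm T\mathcal C$ is the class of trivially cofibrant objects and $\mathcal F$ the class of fibrant objects, are mutually inverse bijections between $S^C$ and $S^M$. -/

import Mathlib

open CategoryTheory CategoryTheory.Limits

universe v u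

namespace ExactCat

section Exact

variable {A : Type u} [Category.{v} A] [Preadditive A]

/-- `i` is the first morphism of a member `(i, d)` of a class `P` of short complexes. -/
def IsInflationOf (P : ObjectProperty (ShortComplex A)) {X Y : A} (i : X ⟶ Y) : Prop :=
  ∃ (Z : A) (d : Y ⟶ Z) (w : i ≫ d = 0), P (ShortComplex.mk i d w)

/-- `d` is the second morphism of a member `(i, d)` of a class `P` of short complexes. -/
def IsDeflationOf (P : ObjectProperty (ShortComplex A)) {Y Z : A} (d : Y ⟶ Z) : Prop :=
  ∃ (X : A) (i : X ⟶ Y) (w : i ≫ d = 0), P (ShortComplex.mk i d w)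

end Exact

open scoped ZeroObject in
/-- An exact structure (in Keller's axiomatization) on an additive category `A`, i.e. on a
preadditive category with a zero object and binary biproducts: a class of kernel-cokernel pairs,
called conflations, whose first (second) morphisms are called inflations (deflations). -/
structure ExactStructure (A : Type u) [Category.{v} A] [Preadditive A] [HasZeroObject A]
    [HasBinaryBiproducts A] where
  conflation : ObjectProperty (ShortComplex A)
  isKernel : ∀ S, conflation S → Nonempty (IsLimit (KernelFork.ofι S.f S.zero))
  isCokernel : ∀ S, conflation S → Nonempty (IsColimit (CokernelCofork.ofπ S.g S.zero))
  of_iso : ∀ ⦃S T : ShortComplex A⦄, (S ≅ T) → conflation S → conflation T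
  id_zero : IsDeflationOf conflation (𝟙 (0 : A))
  comp_deflation : ∀ ⦃X Y Z : A⦄ (d : X ⟶ Y) (e : Y ⟶ Z), IsDeflationOf conflation d →
    IsDeflationOf conflation e → IsDeflationOf conflation (d ≫ e)
  pullback_deflation : ∀ ⦃Y Z Z' : A⦄ (d : Y ⟶ Z) (f : Z' ⟶ Z), IsDeflationOf conflation d →
    ∃ (Y' : A) (f' : Y' ⟶ Y) (d' : Y' ⟶ Z'), IsPullback f' d' d f ∧ IsDeflationOf conflation d'
  pushout_inflation : ∀ ⦃X Y X' : A⦄ (i : X ⟶ Y) (f : X ⟶ X'), IsInflationOf conflation i →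
    ∃ (Y' : A) (i' : X' ⟶ Y') (f' : Y ⟶ Y'), IsPushout i f f' i' ∧ IsInflationOf conflation i'

/-- Weak idempotent completeness: every split epimorphism has a kernel. -/
def WeaklyIdempotentComplete (A : Type u) [Category.{v} A] [Preadditive A] : Prop :=
  ∀ ⦃Y Z : A⦄ (r : Y ⟶ Z), IsSplitEpi r → HasKernel r

/-- `ω` is covariantly finite: every object `M` has a left `ω`-approximation, that is, a morphism
`M ⟶ W` with `W` in `ω` through which every morphism from `M` to an object of `ω` factors. -/
def CovariantlyFinite {A : Type u} [Category.{v} A] (ω : ObjectProperty A) : Prop :=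
  ∀ M : A, ∃ (W : A) (f : M ⟶ W), ω W ∧
    ∀ ⦃W' : A⦄ (g : M ⟶ W'), ω W' → ∃ h : W ⟶ W', f ≫ h = g

/-- Three classes of morphisms: cofibrations, fibrations and weak equivalences. -/
@[ext]
structure MorphismTriple (A : Type u) [Category.{v} A] where
  cofib : MorphismProperty A
  fib : MorphismProperty A
  weq : MorphismProperty A

namespace MorphismTriple

variable {A : Type u} [Category.{v} A] (M : MorphismTriple A)

/-- The axioms of a (closed) model structure; no limits or colimits are required. -/
structure IsModelStructure : Prop where
  two_out_of_three : M.weq.HasTwoOutOfThreeProperty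
  retract_cofib : M.cofib.IsStableUnderRetracts
  retract_fib : M.fib.IsStableUnderRetracts
  retract_weq : M.weq.IsStableUnderRetracts
  lifting : ∀ ⦃X Y Z W : A⦄ (i : X ⟶ Y) (p : Z ⟶ W), M.cofib i → M.fib p →
    (M.weq i ∨ M.weq p) → HasLiftingProperty i p
  factor_trivial_cofib : ∀ ⦃X Y : A⦄ (f : X ⟶ Y), ∃ (Z : A) (i : X ⟶ Z) (p : Z ⟶ Y),
    M.cofib i ∧ M.weq i ∧ M.fib p ∧ i ≫ p = f
  factor_trivial_fib : ∀ ⦃X Y : A⦄ (f : X ⟶ Y), ∃ (Z : A) (j : X ⟶ Z) (q : Z ⟶ Y),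
    M.cofib j ∧ M.fib q ∧ M.weq q ∧ j ≫ q = f

variable [HasZeroMorphisms A] [HasZeroObject A]

open scoped ZeroObject

/-- The class of cofibrant objects. -/
def cofibrant : ObjectProperty A := fun X => M.cofib (0 : (0 : A) ⟶ X)

/-- The class of fibrant objects. -/
def fibrant : ObjectProperty A := fun X => M.fib (0 : X ⟶ (0 : A))

/-- The class of trivial objects. -/
def trivialObj : ObjectProperty A := fun X => M.weq (0 : (0 : A) ⟶ X)

/-- The class of trivially cofibrant objects. -/
def triviallyCofibrant : ObjectProperty A := fun X => M.cofibrant X ∧ M.trivialObj X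

/-- The pair (trivially cofibrant objects, fibrant objects). -/
def objectPair : ObjectProperty A × ObjectProperty A := (M.triviallyCofibrant, M.fibrant)

end MorphismTriple

namespace ExactStructure

variable {A : Type u} [Category.{v} A] [Preadditive A] [HasZeroObject A] [HasBinaryBiproducts A]
  (E : ExactStructure A)

/-- An extension of `X` by `Y`: a conflation `Y ⟶ mid ⟶ X`. -/
structure Extension (X Y : A) where
  mid : A
  i : Y ⟶ mid
  d : mid ⟶ X
  w : i ≫ d = 0
  conflation : E.conflation (ShortComplex.mk i d w)

/-- Equivalence of extensions: an isomorphism of the middle terms that is compatible with the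
identities at both ends. -/
def extensionSetoid (X Y : A) : Setoid (E.Extension X Y) where
  r S T := ∃ e : S.mid ≅ T.mid, S.i ≫ e.hom = T.i ∧ e.hom ≫ T.d = S.d
  iseqv :=
    { refl := fun S => ⟨Iso.refl _, by simp, by simp⟩
      symm := by
        rintro S T ⟨e, h₁, h₂⟩
        exact ⟨e.symm, by simp [← h₁], by simp [← h₂]⟩
      trans := by
        rintro S T U ⟨e, h₁, h₂⟩ ⟨e', h₁', h₂'⟩
        exact ⟨e ≪≫ e', by simp [← h₁', ← h₁], by simp [h₂', h₂]⟩ }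

/-- The underlying set of the Yoneda extension group `Ext¹(X, Y)`. -/
def Ext1 (X Y : A) : Type (max u v) := Quotient (E.extensionSetoid X Y)

/-- `Ext¹(X, Y) = 0`. The zero of the group `Ext¹(X, Y)` is the class of the split extension, so
the group vanishes iff its underlying set has at most one element. -/
def Ext1Vanishes (X Y : A) : Prop := Subsingleton (E.Ext1 X Y)

/-- Cotorsion pairs: `𝒳 = {X | Ext¹(X, 𝒴) = 0}` and `𝒴 = {Y | Ext¹(𝒳, Y) = 0}`. -/
def IsCotorsionPair (𝒳 𝒴 : ObjectProperty A) : Prop :=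
  (∀ X, 𝒳 X ↔ ∀ Y, 𝒴 Y → E.Ext1Vanishes X Y) ∧ (∀ Y, 𝒴 Y ↔ ∀ X, 𝒳 X → E.Ext1Vanishes X Y)

/-- Completeness: every object `M` fits in conflations `Y ⟶ X ⟶ M` and `M ⟶ Y' ⟶ X'` with
`X, X'` in `𝒳` and `Y, Y'` in `𝒴`. -/
def IsCompletePair (𝒳 𝒴 : ObjectProperty A) : Prop :=
  ∀ M : A,
    (∃ (Y X : A) (i : Y ⟶ X) (d : X ⟶ M) (w : i ≫ d = 0),
      𝒴 Y ∧ 𝒳 X ∧ E.conflation (ShortComplex.mk i d w)) ∧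
    (∃ (Y' X' : A) (i : M ⟶ Y') (d : Y' ⟶ X') (w : i ≫ d = 0),
      𝒴 Y' ∧ 𝒳 X' ∧ E.conflation (ShortComplex.mk i d w))

/-- Heredity: `𝒳` is closed under kernels of deflations, `𝒴` under cokernels of inflations. -/
def IsHereditaryPair (𝒳 𝒴 : ObjectProperty A) : Prop :=
  (∀ S, E.conflation S → 𝒳 S.X₂ → 𝒳 S.X₃ → 𝒳 S.X₁) ∧
  (∀ S, E.conflation S → 𝒴 S.X₁ → 𝒴 S.X₂ → 𝒴 S.X₃)

/-- Inflations with cokernel in `𝒳`. -/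
def inflationsWithCokernel (𝒳 : ObjectProperty A) : MorphismProperty A := fun _ B f =>
  ∃ (C : A) (d : B ⟶ C) (w : f ≫ d = 0), E.conflation (ShortComplex.mk f d w) ∧ 𝒳 C

/-- Deflations with kernel in `𝒴`. -/
def deflationsWithKernel (𝒴 : ObjectProperty A) : MorphismProperty A := fun B _ f =>
  ∃ (K : A) (i : K ⟶ B) (w : i ≫ f = 0), E.conflation (ShortComplex.mk i f w) ∧ 𝒴 K

/-- The dual `ω`-model structure attached to a pair `(𝒳, 𝒴)`, with `ω = 𝒳 ∩ 𝒴`: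
cofibrations are the `ω`-monic morphisms, fibrations are the deflations with kernel in `𝒴`, and
`f : M ⟶ N` is a weak equivalence if for some `t : M ⟶ W` with `W` in `ω` the morphism
`(f, t) : M ⟶ N ⊞ W` is an inflation with cokernel in `𝒳`. -/
noncomputable def dualOmega (P : ObjectProperty A × ObjectProperty A) : MorphismTriple A where
  cofib := fun _ N f =>
    ∀ W : A, P.1 W → P.2 W → Function.Surjective (fun g : N ⟶ W => f ≫ g)
  fib := E.deflationsWithKernel P.2
  weq := fun M _ f => ∃ (W : A) (t : M ⟶ W), (P.1 W ∧ P.2 W) ∧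
    E.inflationsWithCokernel P.1 (biprod.lift f t)

/-- The class of hereditary complete cotorsion pairs `(𝒳, 𝒴)` whose core `𝒳 ∩ 𝒴` is
covariantly finite. -/
def cotorsionPairs : Set (ObjectProperty A × ObjectProperty A) :=
  {P | E.IsCotorsionPair P.1 P.2 ∧ E.IsCompletePair P.1 P.2 ∧ E.IsHereditaryPair P.1 P.2 ∧
    CovariantlyFinite (P.1 ⊓ P.2)}

/-- The class of weakly injective model structures: fibrations are precisely the deflations with
fibrant kernel, each trivial cofibration is an inflation, and each object is cofibrant. -/
def weaklyInjectiveModelStructures : Set (MorphismTriple A) :=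
  {M | M.IsModelStructure ∧
    M.fib = E.deflationsWithKernel M.fibrant ∧
    (∀ ⦃X Y : A⦄ (f : X ⟶ Y), M.cofib f → M.weq f → IsInflationOf E.conflation f) ∧
    ∀ X : A, M.cofibrant X}

end ExactStructure

end ExactCat

/-!
Let `ω` be the core of a complete hereditary cotorsion pair `(𝒳, 𝒴)`. The inflations with cokernel
in `𝒳` and the deflations with kernel in `𝒴` form a weak factorization system, and so do the
`ω`-monic morphisms and the split epimorphisms with kernel in `ω`. The key point is that the weak
equivalences are the morphisms `f` such that `Hom(f, Y)` is bijective in the stable category `A/ω`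
for all `Y` in `𝒴`: two-out-of-three and stability under retracts are immediate from this, and it
identifies the two classes just named as the trivial cofibrations and the trivial fibrations.

Conversely, a lifting problem between an inflation and a deflation is governed by `Ext¹` of its
cokernel with its kernel, so that the weak factorization system of trivial cofibrations and
fibrations of a weakly injective model structure is a complete cotorsion pair. Since all objects are
cofibrant, trivial fibrations split, hence the cofibrations are exactly the `ω`-monic morphisms.
-/

namespace ExactCat

open scoped ZeroObject

/-! ### Stable equivalences -/

section Stable

lemma isLocal_isStableUnderRetracts {A : Type u} [Category.{v} A] (P : ObjectProperty A) :
    P.isLocal.IsStableUnderRetracts where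
  of_retract {X Y Z W f g} r hg T hT := by
    refine ⟨fun a b (hab : f ≫ a = f ≫ b) => ?_, fun a => ?_⟩
    · have h : r.r.right ≫ a = r.r.right ≫ b :=
        (hg T hT).injective (by simp only [← r.r_w_assoc, hab])
      simpa using r.i.right ≫= h
    · obtain ⟨b, hb : g ≫ b = r.r.left ≫ a⟩ := (hg T hT).surjective (r.r.left ≫ a)
      exact ⟨r.i.right ≫ b, by simp [← r.i_w_assoc, hb]⟩

variable {A : Type u} [Category.{v} A] [Preadditive A]

/-- Split epimorphisms whose kernel exists and lies in `ω`. They are the trivial fibrations of the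
dual `ω`-model structure. -/
def splitEpisWithKernel (ω : ObjectProperty A) : MorphismProperty A := fun X _ p =>
  ∃ (K : A) (k : K ⟶ X) (w : k ≫ p = 0), Nonempty (ShortComplex.mk k p w).Splitting ∧ ω K

lemma llp_splitEpisWithKernel_iff [HasZeroObject A] {ω : ObjectProperty A} {B C : A} {f : B ⟶ C} :
    (splitEpisWithKernel ω).llp f ↔
      ∀ W, ω W → Function.Surjective fun g : C ⟶ W => f ≫ g := by
  refine ⟨fun hf W hW g => ?_, fun hf X Y p hp => ⟨fun {u v} sq => ?_⟩⟩
  · have := hf (0 : W ⟶ 0) ⟨W, 𝟙 W, comp_zero, ⟨{ r := 𝟙 W, s := 0 }⟩, hW⟩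
    have sq : CommSq g f (0 : W ⟶ 0) 0 := ⟨by simp⟩
    exact ⟨sq.lift, sq.fac_left⟩
  · obtain ⟨K, k, w, ⟨σ⟩, hK⟩ := hp
    obtain ⟨m, hm : f ≫ m = u ≫ σ.r⟩ := hf K hK (u ≫ σ.r)
    refine ⟨⟨⟨m ≫ k + v ≫ σ.s, ?_, by simp [w, σ.s_g]⟩⟩⟩
    simpa [reassoc_of% hm, reassoc_of% sq.w] using u ≫= σ.id

lemma splitEpisWithKernel_biprod_fst [HasBinaryBiproducts A] {ω : ObjectProperty A} (X : A) {W : A}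
    (hW : ω W) : splitEpisWithKernel ω (biprod.fst : X ⊞ W ⟶ X) :=
  ⟨W, biprod.inr, by simp, ⟨{ r := biprod.snd, s := biprod.inl }⟩, hW⟩

/-- The relation on parallel morphisms whose quotient is the stable category `A/ω`: the difference
factors through an object of `ω`. -/
def stableRel (ω : ObjectProperty A) : HomRel A := fun X Y f g =>
  ∃ (W : A) (a : X ⟶ W) (b : W ⟶ Y), ω W ∧ a ≫ b = f - g

/-- The morphisms which induce bijections `Hom(-, Y)` in the stable category `A/ω` for all `Y` in
`𝒴`. -/
def stableEquivalences (ω 𝒴 : ObjectProperty A) : MorphismProperty A :=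
  (ObjectProperty.isLocal fun Y : Quotient (stableRel ω) => 𝒴 Y.as).inverseImage
    (Quotient.functor (stableRel ω))

variable {ω 𝒴 : ObjectProperty A}

lemma stableRel_congruence [HasBinaryBiproducts A] (hω : ∃ W, ω W)
    (hω' : ∀ {X Y : A}, ω X → ω Y → ω (X ⊞ Y)) : Congruence (stableRel ω) where
  equivalence :=
    { refl := fun f =>
        let ⟨W, hW⟩ := hω
        ⟨W, 0, 0, hW, by simp⟩
      symm := by
        rintro f g ⟨W, a, b, hW, h⟩
        exact ⟨W, a, -b, hW, by simp [h]⟩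
      trans := by
        rintro f g l ⟨W, a, b, hW, h⟩ ⟨W', a', b', hW', h'⟩
        exact ⟨W ⊞ W', biprod.lift a a', biprod.desc b b', hω' hW hW', by simp [h, h']⟩ }
  comp_left {_ _ _} f {g g'} := by
    rintro ⟨W, a, b, hW, h⟩
    exact ⟨W, f ≫ a, b, hW, by simp [h]⟩
  comp_right {_ _ _ f f'} g := by
    rintro ⟨W, a, b, hW, h⟩
    exact ⟨W, a, b ≫ g, hW, by simp [reassoc_of% h]⟩

lemma stableEquivalences_iff [Congruence (stableRel ω)] {B C : A} {f : B ⟶ C} :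
    stableEquivalences ω 𝒴 f ↔ ∀ Y, 𝒴 Y →
      (∀ h h' : C ⟶ Y, stableRel ω (f ≫ h) (f ≫ h') → stableRel ω h h') ∧
        ∀ g : B ⟶ Y, ∃ h : C ⟶ Y, stableRel ω (f ≫ h) g := by
  have hF {X Y : A} (a b : X ⟶ Y) : (Quotient.functor (stableRel ω)).map a =
      (Quotient.functor (stableRel ω)).map b ↔ stableRel ω a b := Quotient.functor_map_eq_iff _ a b
  constructor
  · refine fun hf Y hY => ⟨fun h h' hh => ?_, fun g => ?_⟩
    · refine (hF _ _).1 ((hf ⟨Y⟩ hY).injective ?_)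
      simpa only [← Functor.map_comp, hF] using hh
    · obtain ⟨l, hl⟩ := (hf ⟨Y⟩ hY).surjective ((Quotient.functor _).map g)
      obtain ⟨l, rfl⟩ := (Quotient.functor (stableRel ω)).map_surjective (X := C) (Y := Y) l
      exact ⟨l, by simpa only [← Functor.map_comp, hF] using hl⟩
  · rintro hf ⟨Y⟩ hY
    refine ⟨fun a b hab => ?_, fun g => ?_⟩
    · obtain ⟨a, rfl⟩ := (Quotient.functor (stableRel ω)).map_surjective (X := C) (Y := Y) a
      obtain ⟨b, rfl⟩ := (Quotient.functor (stableRel ω)).map_surjective (X := C) (Y := Y) b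
      refine (hF _ _).2 ((hf Y hY).1 _ _ ?_)
      simpa only [← Functor.map_comp, hF] using hab
    · obtain ⟨g, rfl⟩ := (Quotient.functor (stableRel ω)).map_surjective (X := B) (Y := Y) g
      obtain ⟨l, hl⟩ := (hf Y hY).2 g
      exact ⟨(Quotient.functor _).map l, by simpa only [← Functor.map_comp, hF] using hl⟩

lemma splitEpisWithKernel_le_stableEquivalences [Congruence (stableRel ω)] :
    splitEpisWithKernel ω ≤ stableEquivalences ω 𝒴 := by
  rintro Z B p ⟨K, k, w, ⟨σ⟩, hK⟩
  refine stableEquivalences_iff.2 fun Y _ => ⟨fun a b hab => ?_, fun g => ?_⟩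
  · simpa [reassoc_of% σ.s_g] using HomRel.comp_left σ.s hab
  · exact ⟨σ.s ≫ g, K, -σ.r, k ≫ g, hK, by simp [σ.g_s_assoc]⟩

instance : (stableEquivalences ω 𝒴).HasTwoOutOfThreeProperty :=
  inferInstanceAs (MorphismProperty.inverseImage _ _).HasTwoOutOfThreeProperty

instance : (stableEquivalences ω 𝒴).IsStableUnderRetracts :=
  have := isLocal_isStableUnderRetracts fun Y : Quotient (stableRel ω) => 𝒴 Y.as
  inferInstanceAs (MorphismProperty.inverseImage _ _).IsStableUnderRetracts

end Stable

/-! ### Model structures -/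

namespace MorphismTriple

variable {A : Type u} [Category.{v} A] {M : MorphismTriple A}

lemma isModelStructure_of_isWeakFactorizationSystem [M.weq.HasTwoOutOfThreeProperty]
    [M.weq.IsStableUnderRetracts] [h₁ : (M.cofib ⊓ M.weq).IsWeakFactorizationSystem M.fib]
    [h₂ : M.cofib.IsWeakFactorizationSystem (M.fib ⊓ M.weq)] : M.IsModelStructure where
  two_out_of_three := inferInstance
  retract_cofib := h₂.llp ▸ inferInstance
  retract_fib := h₁.rlp ▸ inferInstance
  retract_weq := inferInstance
  lifting _ _ _ _ i p hi hp hw := by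
    obtain hw | hw := hw
    · exact (h₁.llp.ge i ⟨hi, hw⟩) p hp
    · exact (h₂.llp.ge i hi) p ⟨hp, hw⟩
  factor_trivial_cofib _ _ f :=
    let d := MorphismProperty.factorizationData (M.cofib ⊓ M.weq) M.fib f
    ⟨_, d.i, d.p, d.hi.1, d.hi.2, d.hp, d.fac⟩
  factor_trivial_fib _ _ f :=
    let d := MorphismProperty.factorizationData M.cofib (M.fib ⊓ M.weq) f
    ⟨_, d.i, d.p, d.hi, d.hp.1, d.hp.2, d.fac⟩

namespace IsModelStructure

variable (hM : M.IsModelStructure)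

include hM

lemma isWeakFactorizationSystem_trivial_cofib_fib :
    (M.cofib ⊓ M.weq).IsWeakFactorizationSystem M.fib := by
  have := hM.retract_cofib
  have := hM.retract_weq
  have := hM.retract_fib
  have : (M.cofib ⊓ M.weq).HasFactorization M.fib := ⟨fun f =>
    let ⟨Z, i, p, hi, hi', hp, hf⟩ := hM.factor_trivial_cofib f
    ⟨⟨Z, i, p, hf, ⟨hi, hi'⟩, hp⟩⟩⟩
  exact .mk' _ _ fun i p hi hp => hM.lifting i p hi.1 hp (.inl hi.2)

lemma isWeakFactorizationSystem_cofib_trivial_fib :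
    M.cofib.IsWeakFactorizationSystem (M.fib ⊓ M.weq) := by
  have := hM.retract_cofib
  have := hM.retract_weq
  have := hM.retract_fib
  have : M.cofib.HasFactorization (M.fib ⊓ M.weq) := ⟨fun f =>
    let ⟨Z, i, p, hi, hp, hp', hf⟩ := hM.factor_trivial_fib f
    ⟨⟨Z, i, p, hf, hi, ⟨hp, hp'⟩⟩⟩⟩
  exact .mk' _ _ fun i p hi hp => hM.lifting i p hi hp.1 (.inr hp.2)

lemma llp_fib : M.fib.llp = M.cofib ⊓ M.weq :=
  hM.isWeakFactorizationSystem_trivial_cofib_fib.llp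

lemma rlp_trivial_cofib : (M.cofib ⊓ M.weq).rlp = M.fib :=
  hM.isWeakFactorizationSystem_trivial_cofib_fib.rlp

lemma llp_trivial_fib : (M.fib ⊓ M.weq).llp = M.cofib :=
  hM.isWeakFactorizationSystem_cofib_trivial_fib.llp

lemma rlp_cofib : M.cofib.rlp = M.fib ⊓ M.weq :=
  hM.isWeakFactorizationSystem_cofib_trivial_fib.rlp

lemma weq_id (X : A) : M.weq (𝟙 X) :=
  (hM.llp_fib.le _ (MorphismProperty.llp_of_isIso _ _)).2

lemma weq_le {M' : MorphismTriple A} (hM' : M'.IsModelStructure) (hc : M.cofib = M'.cofib)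
    (hf : M.fib = M'.fib) : M.weq ≤ M'.weq := fun X Y f hw => by
  have := hM.two_out_of_three
  have := hM'.two_out_of_three
  obtain ⟨Z, i, p, hi, hi', hp, rfl⟩ := hM.factor_trivial_cofib f
  have hi₁ : (M'.cofib ⊓ M'.weq) i := by
    rw [← hM'.llp_fib, ← hf, hM.llp_fib]
    exact ⟨hi, hi'⟩
  have hp₁ : (M'.fib ⊓ M'.weq) p := by
    rw [← hM'.rlp_cofib, ← hc, hM.rlp_cofib]
    exact ⟨hp, M.weq.of_precomp i p hi' hw⟩
  exact M'.weq.comp_mem _ _ hi₁.2 hp₁.2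

lemma ext {M' : MorphismTriple A} (hM' : M'.IsModelStructure) (hc : M.cofib = M'.cofib)
    (hf : M.fib = M'.fib) : M = M' :=
  MorphismTriple.ext hc hf ((hM.weq_le hM' hc hf).antisymm (hM'.weq_le hM hc.symm hf.symm))

lemma weq_to_zero_iff [HasZeroMorphisms A] [HasZeroObject A] (X : A) :
    M.weq (0 : X ⟶ 0) ↔ M.trivialObj X := by
  have := hM.two_out_of_three
  have h : M.weq ((0 : 0 ⟶ X) ≫ (0 : X ⟶ 0)) := by
    rw [(isZero_zero A).eq_of_src ((0 : 0 ⟶ X) ≫ (0 : X ⟶ 0)) (𝟙 0)]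
    exact hM.weq_id _
  exact ⟨fun hX => M.weq.of_postcomp _ _ hX h, fun hX => M.weq.of_precomp _ _ hX h⟩

end IsModelStructure

end MorphismTriple

lemma WeaklyIdempotentComplete.exists_splitting {A : Type u} [Category.{v} A] [Preadditive A]
    (hA : WeaklyIdempotentComplete A) {B C : A} {r : B ⟶ C} {s : C ⟶ B} (hs : s ≫ r = 𝟙 C) :
    ∃ (K : A) (k : K ⟶ B) (w : k ≫ r = 0), Nonempty (ShortComplex.mk k r w).Splitting := by
  have := hA r ⟨⟨s, hs⟩⟩
  have hr : (𝟙 B - r ≫ s) ≫ r = 0 := by simp [hs]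
  exact ⟨kernel r, kernel.ι r, kernel.condition r,
    ⟨{ r := kernel.lift r _ hr, s := s, f_r := by simp [← cancel_mono (kernel.ι r)] }⟩⟩

namespace ExactStructure

variable {A : Type u} [Category.{v} A] [Preadditive A] [HasZeroObject A] [HasBinaryBiproducts A]
  {E : ExactStructure A}

/-! ### Conflations -/

variable (E) in
/-- The morphisms `i` and `d` form a conflation; that their composite vanishes is part of the
assertion. -/
def IsConflation {X Y Z : A} (i : X ⟶ Y) (d : Y ⟶ Z) : Prop :=
  ∃ w : i ≫ d = 0, E.conflation (ShortComplex.mk i d w)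

lemma isInflationOf_iff {X Y : A} {i : X ⟶ Y} :
    IsInflationOf E.conflation i ↔ ∃ (Z : A) (d : Y ⟶ Z), E.IsConflation i d :=
  Iff.rfl

lemma isDeflationOf_iff {Y Z : A} {d : Y ⟶ Z} :
    IsDeflationOf E.conflation d ↔ ∃ (X : A) (i : X ⟶ Y), E.IsConflation i d :=
  Iff.rfl

lemma inflationsWithCokernel_iff {𝒳 : ObjectProperty A} {X Y : A} {i : X ⟶ Y} :
    E.inflationsWithCokernel 𝒳 i ↔ ∃ (Z : A) (d : Y ⟶ Z), E.IsConflation i d ∧ 𝒳 Z := by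
  simp only [inflationsWithCokernel, IsConflation, exists_and_right]

lemma deflationsWithKernel_iff {𝒴 : ObjectProperty A} {Y Z : A} {d : Y ⟶ Z} :
    E.deflationsWithKernel 𝒴 d ↔ ∃ (X : A) (i : X ⟶ Y), E.IsConflation i d ∧ 𝒴 X := by
  simp only [deflationsWithKernel, IsConflation, exists_and_right]

namespace IsConflation

variable {X Y Z : A} {i : X ⟶ Y} {d : Y ⟶ Z}

lemma w (h : E.IsConflation i d) : i ≫ d = 0 := h.1

lemma isInflationOf (h : E.IsConflation i d) : IsInflationOf E.conflation i := ⟨_, _, h⟩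

lemma isDeflationOf (h : E.IsConflation i d) : IsDeflationOf E.conflation d := ⟨_, _, h⟩

lemma mono (h : E.IsConflation i d) : Mono i :=
  Fork.IsLimit.mono (E.isKernel _ h.2).some

lemma epi (h : E.IsConflation i d) : Epi d :=
  Cofork.IsColimit.epi (E.isCokernel _ h.2).some

lemma exists_lift (h : E.IsConflation i d) {T : A} (x : T ⟶ Y) (hx : x ≫ d = 0) :
    ∃ l : T ⟶ X, l ≫ i = x :=
  let l := KernelFork.IsLimit.lift' (E.isKernel _ h.2).some x hx
  ⟨l.1, l.2⟩

lemma exists_desc (h : E.IsConflation i d) {T : A} (x : Y ⟶ T) (hx : i ≫ x = 0) :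
    ∃ l : Z ⟶ T, d ≫ l = x :=
  let l := CokernelCofork.IsColimit.desc' (E.isCokernel _ h.2).some x hx
  ⟨l.1, l.2⟩

lemma of_iso (h : E.IsConflation i d) {X' Y' Z' : A} {i' : X' ⟶ Y'} {d' : Y' ⟶ Z'}
    (e₁ : X ≅ X') (e₂ : Y ≅ Y') (e₃ : Z ≅ Z') (h₁ : e₁.hom ≫ i' = i ≫ e₂.hom)
    (h₂ : e₂.hom ≫ d' = d ≫ e₃.hom) : E.IsConflation i' d' := by
  have w' : i' ≫ d' = 0 := by
    rw [← cancel_epi e₁.hom, reassoc_of% h₁, h₂, reassoc_of% h.w, zero_comp, comp_zero]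
  exact ⟨w', E.of_iso (ShortComplex.isoMk (S₁ := .mk i d h.w) (S₂ := .mk i' d' w')
    e₁ e₂ e₃ h₁ h₂) h.2⟩

lemma of_kernel (h : E.IsConflation i d) {X' : A} (i' : X' ⟶ Y) [Mono i'] (w' : i' ≫ d = 0)
    (hl : ∀ ⦃T : A⦄ (x : T ⟶ Y), x ≫ d = 0 → ∃ l : T ⟶ X', l ≫ i' = x) :
    E.IsConflation i' d := by
  obtain ⟨a, ha⟩ := h.exists_lift i' w'
  obtain ⟨b, hb⟩ := hl i h.w
  have := h.mono
  exact h.of_iso ⟨b, a, by simp [← cancel_mono i, ha, hb], by simp [← cancel_mono i', ha, hb]⟩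
    (Iso.refl _) (Iso.refl _) (by simpa) (by simp)

lemma of_cokernel (h : E.IsConflation i d) {Z' : A} (d' : Y ⟶ Z') [Epi d'] (w' : i ≫ d' = 0)
    (hl : ∀ ⦃T : A⦄ (x : Y ⟶ T), i ≫ x = 0 → ∃ l : Z' ⟶ T, d' ≫ l = x) :
    E.IsConflation i d' := by
  obtain ⟨a, ha⟩ := h.exists_desc d' w'
  obtain ⟨b, hb⟩ := hl d h.w
  have := h.epi
  exact h.of_iso (Iso.refl _) (Iso.refl _)
    ⟨a, b, by simp [← cancel_epi d, reassoc_of% ha, hb],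
      by simp [← cancel_epi d', reassoc_of% hb, ha]⟩ (by simp) (by simpa using ha.symm)

lemma of_isPushout (h : E.IsConflation i d) {X' Y' : A} {f : X ⟶ X'} {f' : Y ⟶ Y'} {i' : X' ⟶ Y'}
    (sq : IsPushout i f f' i') : ∃ d' : Y' ⟶ Z, f' ≫ d' = d ∧ E.IsConflation i' d' := by
  obtain ⟨d', h₁, h₂⟩ := sq.exists_desc d (0 : X' ⟶ Z) (by simp [h.w])
  obtain ⟨Y'', i'', f'', sq', Q, q, hq⟩ := E.pushout_inflation i f h.isInflationOf
  have := h.epi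
  have : Epi d' := epi_of_epi_fac h₁
  let e := sq'.isoIsPushout _ _ sq
  have hi : E.IsConflation i' (e.inv ≫ q) :=
    of_iso hq (Iso.refl _) e (Iso.refl _) (by simp [e]) (by simp)
  refine ⟨d', h₁, hi.of_cokernel d' h₂ fun T x hx => ?_⟩
  obtain ⟨l, hl⟩ := h.exists_desc (f' ≫ x) (by rw [reassoc_of% sq.w, hx, comp_zero])
  exact ⟨l, sq.hom_ext (by rw [reassoc_of% h₁, hl]) (by rw [reassoc_of% h₂, hx, zero_comp])⟩

lemma of_isPullback (h : E.IsConflation i d) {Y' Z' : A} {f : Z' ⟶ Z} {f' : Y' ⟶ Y} {d' : Y' ⟶ Z'}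
    (sq : IsPullback f' d' d f) : ∃ i' : X ⟶ Y', i' ≫ f' = i ∧ E.IsConflation i' d' := by
  obtain ⟨i', h₁, h₂⟩ := sq.exists_lift i (0 : X ⟶ Z') (by simp [h.w])
  obtain ⟨Y'', f'', d'', sq', Q, q, hq⟩ := E.pullback_deflation d f h.isDeflationOf
  have := h.mono
  have : Mono i' := mono_of_mono_fac h₁
  let e := sq'.isoIsPullback _ _ sq
  have hi : E.IsConflation (q ≫ e.hom) d' :=
    of_iso hq (Iso.refl _) e (Iso.refl _) (by simp) (by simp [e])
  refine ⟨i', h₁, hi.of_kernel i' h₂ fun T x hx => ?_⟩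
  obtain ⟨l, hl⟩ := h.exists_lift (x ≫ f') (by rw [Category.assoc, sq.w, reassoc_of% hx, zero_comp])
  exact ⟨l, sq.hom_ext (by rw [Category.assoc, h₁, hl]) (by rw [Category.assoc, h₂, hx, comp_zero])⟩

lemma exists_pushout (h : E.IsConflation i d) {X' : A} (f : X ⟶ X') :
    ∃ (Y' : A) (f' : Y ⟶ Y') (i' : X' ⟶ Y') (d' : Y' ⟶ Z), IsPushout i f f' i' ∧
      f' ≫ d' = d ∧ E.IsConflation i' d' := by
  obtain ⟨Y', i', f', sq, -⟩ := E.pushout_inflation i f h.isInflationOf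
  obtain ⟨d', h₁, h₂⟩ := h.of_isPushout sq
  exact ⟨Y', f', i', d', sq, h₁, h₂⟩

lemma exists_pullback (h : E.IsConflation i d) {Z' : A} (f : Z' ⟶ Z) :
    ∃ (Y' : A) (f' : Y' ⟶ Y) (d' : Y' ⟶ Z') (i' : X ⟶ Y'), IsPullback f' d' d f ∧
      i' ≫ f' = i ∧ E.IsConflation i' d' := by
  obtain ⟨Y', f', d', sq, -⟩ := E.pullback_deflation d f h.isDeflationOf
  obtain ⟨i', h₁, h₂⟩ := h.of_isPullback sq
  exact ⟨Y', f', d', i', sq, h₁, h₂⟩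

lemma exists_retract_cokernel (h : E.IsConflation i d) {X' Y' Z' : A} {i' : X' ⟶ Y'}
    {d' : Y' ⟶ Z'} (h' : E.IsConflation i' d') (r : RetractArrow i i') :
    Nonempty (Retract Z Z') := by
  obtain ⟨a, ha⟩ := h.exists_desc (r.i.right ≫ d') (by rw [← reassoc_of% r.i_w, h'.w, comp_zero])
  obtain ⟨b, hb⟩ := h'.exists_desc (r.r.right ≫ d) (by rw [← reassoc_of% r.r_w, h.w, comp_zero])
  have := h.epi
  exact ⟨⟨a, b, by rw [← cancel_epi d, reassoc_of% ha, hb]; simp⟩⟩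

lemma exists_retract_kernel (h : E.IsConflation i d) {X' Y' Z' : A} {i' : X' ⟶ Y'}
    {d' : Y' ⟶ Z'} (h' : E.IsConflation i' d') (r : RetractArrow d d') :
    Nonempty (Retract X X') := by
  obtain ⟨a, ha⟩ := h'.exists_lift (i ≫ r.i.left)
    (by rw [Category.assoc, r.i_w, reassoc_of% h.w, zero_comp])
  obtain ⟨b, hb⟩ := h.exists_lift (i' ≫ r.r.left)
    (by rw [Category.assoc, r.r_w, reassoc_of% h'.w, zero_comp])
  have := h.mono
  exact ⟨⟨a, b, by rw [← cancel_mono i, Category.assoc, hb, reassoc_of% ha]; simp⟩⟩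

end IsConflation

/-! ### Split conflations -/

variable (E) in
lemma isConflation_zero : E.IsConflation (𝟙 (0 : A)) (0 : (0 : A) ⟶ 0) := by
  obtain ⟨X, i, h⟩ := isDeflationOf_iff.1 E.id_zero
  have := h.mono
  have hX : IsZero X := IsZero.of_mono i (isZero_zero A)
  exact h.of_iso hX.isoZero (Iso.refl _) (Iso.refl _)
    ((isZero_zero A).eq_of_tgt _ _) ((isZero_zero A).eq_of_tgt _ _)

variable (E) in
lemma isConflation_id_zero (X : A) : E.IsConflation (𝟙 X) (0 : X ⟶ 0) := by
  obtain ⟨d, -, h⟩ := E.isConflation_zero.of_isPushout (IsPushout.id_horiz (0 : 0 ⟶ X))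
  rwa [(isZero_zero A).eq_of_tgt d 0] at h

variable (E) in
lemma isConflation_zero_id (X : A) : E.IsConflation (0 : 0 ⟶ X) (𝟙 X) := by
  obtain ⟨i, -, h⟩ := E.isConflation_zero.of_isPullback (IsPullback.zero_right X)
  rwa [(isZero_zero A).eq_of_src i 0] at h

variable (E) in
lemma isConflation_inl_snd (X Y : A) : E.IsConflation (biprod.inl : X ⟶ X ⊞ Y) biprod.snd := by
  obtain ⟨i, hi, h⟩ :=
    (E.isConflation_id_zero X).of_isPullback (IsPullback.of_has_biproduct X Y)
  rwa [show i = biprod.inl by ext <;> simp [hi, h.w]] at h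

lemma IsConflation.of_splitting {S : ShortComplex A} (σ : S.Splitting) :
    E.IsConflation S.f S.g :=
  (E.isConflation_inl_snd S.X₁ S.X₃).of_iso (Iso.refl _)
    ⟨biprod.desc S.f σ.s, biprod.lift σ.r S.g, by ext <;> simp, by simp [σ.id]⟩ (Iso.refl _)
    (by simp) (by ext <;> simp)

variable (E) in
lemma isConflation_inr_fst (X Y : A) : E.IsConflation (biprod.inr : Y ⟶ X ⊞ Y) biprod.fst :=
  .of_splitting (S := .mk biprod.inr biprod.fst biprod.inr_fst)
    { r := biprod.snd, s := biprod.inl, id := (add_comm _ _).trans biprod.total }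

namespace IsConflation

variable {X Y Z : A} {i : X ⟶ Y} {d : Y ⟶ Z}

lemma exists_splitting_of_section (h : E.IsConflation i d) {s : Z ⟶ Y} (hs : s ≫ d = 𝟙 Z) :
    ∃ σ : (ShortComplex.mk i d h.w).Splitting, σ.s = s := by
  obtain ⟨r, hr⟩ := h.exists_lift (𝟙 Y - d ≫ s) (by simp [hs])
  have := h.mono
  exact ⟨{ r := r, s := s, s_g := hs, f_r := by simp [← cancel_mono i, hr, reassoc_of% h.w],
           id := by simp [hr] }, rfl⟩

lemma exists_splitting_of_retraction (h : E.IsConflation i d) {r : Y ⟶ X} (hr : i ≫ r = 𝟙 X) :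
    ∃ σ : (ShortComplex.mk i d h.w).Splitting, σ.r = r := by
  obtain ⟨s, hs⟩ := h.exists_desc (𝟙 Y - r ≫ i) (by simp [reassoc_of% hr])
  have := h.epi
  exact ⟨{ r := r, s := s, f_r := hr, s_g := by simp [← cancel_epi d, reassoc_of% hs, h.w],
           id := by simp [hs] }, rfl⟩

/-! ### The isomorphism theorems -/

lemma of_isPullback_kernel {K K' B B' C : A} {r : B' ⟶ B} {g : B ⟶ C} {k : K ⟶ B} [Mono k]
    (w : k ≫ g = 0) (hk : ∀ ⦃T : A⦄ (x : T ⟶ B), x ≫ g = 0 → ∃ l : T ⟶ K, l ≫ k = x)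
    (hrg : IsDeflationOf E.conflation (r ≫ g)) {k' : K' ⟶ B'} {r' : K' ⟶ K}
    (sq : IsPullback k' r' r k) : E.IsConflation k' (r ≫ g) := by
  obtain ⟨N, n, hn⟩ := isDeflationOf_iff.1 hrg
  have : Mono k' := MorphismProperty.of_isPullback (P := .monomorphisms A) sq.flip ‹_›
  refine hn.of_kernel k' (by rw [reassoc_of% sq.w, w, comp_zero]) fun T x hx => ?_
  obtain ⟨y, hy⟩ := hk (x ≫ r) (by simpa using hx)
  obtain ⟨l, hl, -⟩ := sq.exists_lift x y hy.symm
  exact ⟨l, hl⟩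

lemma comp_deflation {P Q : A} (h : E.IsConflation i d) {a : P ⟶ Q} {p' : P ⟶ X} {p : Q ⟶ Y}
    (sq : IsPullback a p' p i) (hp : IsDeflationOf E.conflation p) :
    E.IsConflation a (p ≫ d) :=
  have := h.mono
  of_isPullback_kernel h.w (fun _ => h.exists_lift) (E.comp_deflation p d hp h.isDeflationOf) sq

lemma cokernel_comparison {K N M B C : A} {s : X ⟶ N} {t : N ⟶ K} {n : N ⟶ M} {q : M ⟶ C}
    {p : M ⟶ B} (h : E.IsConflation s t) (hn : E.IsConflation n q)
    (hp : E.IsConflation (s ≫ n) p) :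
    ∃ (k : K ⟶ B) (g : B ⟶ C), t ≫ k = n ≫ p ∧ p ≫ g = q ∧ E.IsConflation k g := by
  have := h.epi
  have := hp.epi
  obtain ⟨k, hk⟩ := h.exists_desc (n ≫ p) (by simpa using hp.w)
  have sq : IsPushout n t p k := .mk' hk.symm (fun T a b hab _ => by rwa [← cancel_epi p])
    fun T a b hab => by
      obtain ⟨l, hl⟩ := hp.exists_desc a (by rw [Category.assoc, hab, reassoc_of% h.w, zero_comp])
      exact ⟨l, hl, by rw [← cancel_epi t, reassoc_of% hk, hl, hab]⟩
  obtain ⟨g, hg, hkg⟩ := hn.of_isPushout sq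
  exact ⟨k, g, hk, hg, hkg⟩

lemma kernel_comparison {N M Q K C B : A} {n : N ⟶ M} {q : M ⟶ Q} {k : K ⟶ Q} {r : Q ⟶ C}
    {b : B ⟶ M} (h : E.IsConflation k r) (hn : E.IsConflation n q)
    (hb : E.IsConflation b (q ≫ r)) :
    ∃ (a : N ⟶ B) (e : B ⟶ K), a ≫ b = n ∧ e ≫ k = b ≫ q ∧ E.IsConflation a e := by
  have := h.mono
  have := hb.mono
  obtain ⟨e, he⟩ := h.exists_lift (b ≫ q) (by simpa using hb.w)
  have sq : IsPullback b e q k := .mk' he.symm (fun T x y hxy _ => by rwa [← cancel_mono b])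
    fun T x y hxy => by
      obtain ⟨l, hl⟩ := hb.exists_lift x (by rw [reassoc_of% hxy, h.w, comp_zero])
      exact ⟨l, hl, by rw [← cancel_mono k, Category.assoc, he, reassoc_of% hl, hxy]⟩
  obtain ⟨a, ha, hae⟩ := hn.of_isPullback sq
  exact ⟨a, e, ha, he, hae⟩

end IsConflation

/-- A form of Quillen's obscure axiom. -/
lemma IsConflation.of_deflation_comp {B' B C K : A} {r : B' ⟶ B} {g : B ⟶ C} {k : K ⟶ B} [Mono k]
    (hr : IsDeflationOf E.conflation r) (hrg : IsDeflationOf E.conflation (r ≫ g))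
    (w : k ≫ g = 0) (hk : ∀ ⦃T : A⦄ (x : T ⟶ B), x ≫ g = 0 → ∃ l : T ⟶ K, l ≫ k = x) :
    E.IsConflation k g := by
  obtain ⟨I, ι, hι⟩ := isDeflationOf_iff.1 hr
  obtain ⟨P, k', r', ι', sq, hι', hr'⟩ := hι.exists_pullback k
  have := hr'.epi
  have := hι.epi
  obtain ⟨l, g', hl, hg', h⟩ :=
    hr'.cokernel_comparison (of_isPullback_kernel w hk hrg sq) (hι' ▸ hι)
  rwa [(cancel_epi r').1 (hl.trans sq.w), (cancel_epi r).1 hg'] at h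

lemma isDeflationOf_map_id {X Y : A} {d : X ⟶ Y} (h : IsDeflationOf E.conflation d) (T : A) :
    IsDeflationOf E.conflation (biprod.map d (𝟙 T)) := by
  obtain ⟨K, k, hk⟩ := isDeflationOf_iff.1 h
  have sq : IsPullback biprod.fst (biprod.map d (𝟙 T)) d biprod.fst :=
    .mk' (by simp) (fun S a b h₁ h₂ => by ext; exacts [h₁, by simpa using h₂ =≫ biprod.snd])
      fun S a b hab => ⟨biprod.lift a (b ≫ biprod.snd), by simp, by ext <;> simp [hab]⟩
  obtain ⟨_, -, h'⟩ := hk.of_isPullback sq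
  exact h'.isDeflationOf

lemma isDeflationOf_desc {X Y Z : A} {d : X ⟶ Z} (h : IsDeflationOf E.conflation d) (g : Y ⟶ Z) :
    IsDeflationOf E.conflation (biprod.desc d g) := by
  have hg : E.IsConflation (biprod.lift (-g) (𝟙 Y)) (biprod.desc (𝟙 Z) g) :=
    .of_splitting (S := .mk (biprod.lift (-g) (𝟙 Y)) (biprod.desc (𝟙 Z) g) (by simp))
      { r := biprod.snd, s := biprod.inl }
  have := E.comp_deflation _ _ (isDeflationOf_map_id h Y) hg.isDeflationOf
  rwa [show biprod.map d (𝟙 Y) ≫ biprod.desc (𝟙 Z) g = biprod.desc d g by ext <;> simp] at this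

lemma isDeflationOf_desc_of_isPushout {Y Z C V Q : A} {j : Y ⟶ Z} {q : Z ⟶ Q} {d : Y ⟶ C}
    {d' : Z ⟶ V} {j' : C ⟶ V} (hj : E.IsConflation j q) (sq : IsPushout j d d' j') :
    IsDeflationOf E.conflation (biprod.desc j' d') := by
  obtain ⟨q', hq', hj'⟩ := hj.of_isPushout sq
  have := hj'.mono
  have sq' : IsPullback biprod.snd (biprod.desc j' d') q q' :=
    .mk' (by ext <;> simp [hq', hj'.w])
      (fun T a b h₁ h₂ => by
        refine biprod.hom_ext _ _ ?_ h₁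
        rw [biprod.desc_eq, Preadditive.comp_add, Preadditive.comp_add, reassoc_of% h₁] at h₂
        simpa [← cancel_mono j'] using h₂)
      fun T a b hab => by
        obtain ⟨l, hl⟩ := hj'.exists_lift (b - a ≫ d') (by simp [hab, hq'])
        exact ⟨biprod.lift l a, by simp, by simp [hl]⟩
  obtain ⟨_, -, h⟩ := hj.of_isPullback sq'
  exact h.isDeflationOf

/-- The pushout `d'` of the cokernel `d` of `i` along `j` is a cokernel of `i ≫ j`; it is a
deflation by the obscure axiom, since both `(j, 1)` and `(j, 1) ≫ d' = (d ⊞ 1) ≫ (j', d')` are. -/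
lemma IsConflation.exists_comp {X Y Z C Q : A} {i : X ⟶ Y} {d : Y ⟶ C} (hi : E.IsConflation i d)
    {j : Y ⟶ Z} {q : Z ⟶ Q} (hj : E.IsConflation j q) :
    ∃ (V : A) (d' : Z ⟶ V), E.IsConflation (i ≫ j) d' := by
  obtain ⟨V, d', j', q', sq, hq', hj'⟩ := hj.exists_pushout d
  have := hi.mono
  have := hj.mono
  have := hj'.mono
  have hr : E.IsConflation (biprod.lift (𝟙 Y) (-j)) (biprod.desc j (𝟙 Z)) :=
    .of_splitting (S := .mk (biprod.lift (𝟙 Y) (-j)) (biprod.desc j (𝟙 Z)) (by simp))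
      { r := biprod.fst, s := biprod.inr }
  refine ⟨V, d', .of_deflation_comp hr.isDeflationOf ?_
    (by rw [Category.assoc, sq.w, reassoc_of% hi.w, zero_comp]) fun T x hx => ?_⟩
  · have := E.comp_deflation _ _ (isDeflationOf_map_id hi.isDeflationOf Z)
      (isDeflationOf_desc_of_isPushout hj sq)
    rwa [show biprod.map d (𝟙 Z) ≫ biprod.desc j' d' = biprod.desc j (𝟙 Z) ≫ d' by
      ext <;> simp [sq.w]] at this
  · obtain ⟨y, rfl⟩ := hj.exists_lift x (by rw [← hq', reassoc_of% hx, zero_comp])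
    obtain ⟨l, rfl⟩ := hi.exists_lift y
      (by rw [← cancel_mono j', Category.assoc, ← sq.w, zero_comp]; simpa using hx)
    exact ⟨l, by simp⟩

/-! ### Weak idempotent completeness -/

section WeaklyIdempotentComplete

variable (hA : WeaklyIdempotentComplete A)

include hA

variable (E) in
lemma exists_isConflation_of_section {B C : A} {r : B ⟶ C} {s : C ⟶ B} (hs : s ≫ r = 𝟙 C) :
    ∃ (K : A) (k : K ⟶ B), E.IsConflation k r :=
  let ⟨K, k, _, ⟨σ⟩⟩ := hA.exists_splitting hs
  ⟨K, k, .of_splitting σ⟩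

variable (E) in
lemma exists_isConflation_of_retraction {B C : A} {s : C ⟶ B} {r : B ⟶ C} (hr : s ≫ r = 𝟙 C) :
    ∃ (K : A) (t : B ⟶ K), E.IsConflation s t := by
  obtain ⟨K, k, hk⟩ := exists_isConflation_of_section E hA hr
  obtain ⟨σ, hσ⟩ := hk.exists_splitting_of_section hr
  exact ⟨K, σ.r, .of_splitting (S := .mk s σ.r (hσ ▸ σ.s_r))
    { r := r, s := k, f_r := hr, s_g := σ.f_r, id := by simpa [hσ, add_comm] using σ.id }⟩

lemma isDeflationOf_of_section_of_comp {B' B C : A} {r : B' ⟶ B} {s : B ⟶ B'} {g : B ⟶ C}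
    (hs : s ≫ r = 𝟙 B) (h : IsDeflationOf E.conflation (r ≫ g)) :
    IsDeflationOf E.conflation g := by
  obtain ⟨I, ι, hι⟩ := exists_isConflation_of_section E hA hs
  obtain ⟨N, n, hn⟩ := isDeflationOf_iff.1 h
  obtain ⟨σ, -⟩ := hι.exists_splitting_of_section hs
  obtain ⟨m, rfl⟩ := hn.exists_lift ι (by simp [reassoc_of% hι.w])
  obtain ⟨K, t, ht⟩ := exists_isConflation_of_retraction E hA
    (s := m) (r := n ≫ σ.r) (by simpa using σ.f_r)
  obtain ⟨k, g', -, hg, hkg⟩ := ht.cokernel_comparison hn hι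
  have := hι.epi
  rw [cancel_epi] at hg
  exact hg ▸ hkg.isDeflationOf

lemma isInflationOf_of_retraction_of_comp {X B B' : A} {f : X ⟶ B} {m : B ⟶ B'} {r : B' ⟶ B}
    (hr : m ≫ r = 𝟙 B) (h : IsInflationOf E.conflation (f ≫ m)) :
    IsInflationOf E.conflation f := by
  obtain ⟨C, c, hc⟩ := exists_isConflation_of_retraction E hA hr
  obtain ⟨Q, q, hq⟩ := isInflationOf_iff.1 h
  obtain ⟨σ, -⟩ := hc.exists_splitting_of_retraction hr
  obtain ⟨e, rfl⟩ := hq.exists_desc c (by simp [hc.w])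
  obtain ⟨K, k, hk⟩ := exists_isConflation_of_section E hA
    (r := e) (s := σ.s ≫ q) (by simpa using σ.s_g)
  obtain ⟨f', _, hf, -, hfe⟩ := hk.kernel_comparison hq hc
  have := hc.mono
  rw [cancel_mono] at hf
  exact hf ▸ hfe.isInflationOf

lemma inflationsWithCokernel_isStableUnderRetracts (𝒳 : ObjectProperty A)
    [𝒳.IsStableUnderRetracts] : (E.inflationsWithCokernel 𝒳).IsStableUnderRetracts where
  of_retract {_ _ _ _ f g} h hg := by
    obtain ⟨C, c, hc, hC⟩ := inflationsWithCokernel_iff.1 hg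
    obtain ⟨_, _, hl⟩ := exists_isConflation_of_retraction E hA h.retract_left
    obtain ⟨_, _, hcomp⟩ := hl.exists_comp hc
    rw [h.i_w] at hcomp
    obtain ⟨D, d, hd⟩ := isInflationOf_iff.1
      (isInflationOf_of_retraction_of_comp hA h.retract_right hcomp.isInflationOf)
    obtain ⟨r⟩ := hd.exists_retract_cokernel hc h
    exact inflationsWithCokernel_iff.2 ⟨D, d, hd, 𝒳.prop_of_retract r hC⟩

lemma deflationsWithKernel_isStableUnderRetracts (𝒴 : ObjectProperty A)
    [𝒴.IsStableUnderRetracts] : (E.deflationsWithKernel 𝒴).IsStableUnderRetracts where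
  of_retract {_ _ _ _ f g} h hg := by
    obtain ⟨K, k, hk, hK⟩ := deflationsWithKernel_iff.1 hg
    obtain ⟨_, _, hr⟩ := exists_isConflation_of_section E hA h.retract_right
    have hcomp := E.comp_deflation _ _ hk.isDeflationOf hr.isDeflationOf
    rw [← h.r_w] at hcomp
    obtain ⟨L, l, hl⟩ := isDeflationOf_iff.1
      (isDeflationOf_of_section_of_comp hA h.retract_left hcomp)
    obtain ⟨r⟩ := hl.exists_retract_kernel hk h
    exact deflationsWithKernel_iff.2 ⟨L, l, hl, 𝒴.prop_of_retract r hK⟩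

end WeaklyIdempotentComplete

/-! ### Vanishing of `Ext¹` and lifting properties -/

lemma ext1Vanishes_of_section {X Y : A} (H : ∀ ⦃M : A⦄ (i : Y ⟶ M) (d : M ⟶ X),
    E.IsConflation i d → ∃ s : X ⟶ M, s ≫ d = 𝟙 X) : E.Ext1Vanishes X Y := by
  refine ⟨fun a b => ?_⟩
  induction a using Quotient.inductionOn with | _ S
  induction b using Quotient.inductionOn with | _ T
  have hS : E.IsConflation S.i S.d := ⟨S.w, S.conflation⟩
  have hT : E.IsConflation T.i T.d := ⟨T.w, T.conflation⟩
  obtain ⟨s, hs⟩ := H _ _ hS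
  obtain ⟨t, ht⟩ := H _ _ hT
  obtain ⟨σ, -⟩ := hS.exists_splitting_of_section hs
  obtain ⟨τ, -⟩ := hT.exists_splitting_of_section ht
  exact Quotient.sound
    ⟨{ hom := σ.r ≫ T.i + S.d ≫ τ.s
       inv := τ.r ≫ S.i + T.d ≫ σ.s
       hom_inv_id := by simpa [τ.f_r_assoc, τ.s_g_assoc, τ.s_r_assoc, reassoc_of% T.w] using σ.id
       inv_hom_id := by simpa [σ.f_r_assoc, σ.s_g_assoc, σ.s_r_assoc, reassoc_of% S.w] using τ.id },
      by simp [σ.f_r_assoc, reassoc_of% S.w], by simpa [T.w] using S.d ≫= τ.s_g⟩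

namespace Ext1Vanishes

lemma nonempty_splitting {X Y : A} (hE : E.Ext1Vanishes X Y) {M : A} {i : Y ⟶ M} {d : M ⟶ X}
    (h : E.IsConflation i d) : Nonempty (ShortComplex.mk i d h.w).Splitting := by
  have hb := E.isConflation_inl_snd Y X
  obtain ⟨e, he, -⟩ := Quotient.exact (hE.elim
    (Quotient.mk (E.extensionSetoid X Y) ⟨M, i, d, h.1, h.2⟩)
    (Quotient.mk (E.extensionSetoid X Y) ⟨_, _, _, hb.1, hb.2⟩))
  obtain ⟨σ, -⟩ := h.exists_splitting_of_retraction (r := e.hom ≫ biprod.fst)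
    (by simpa using he =≫ biprod.fst)
  exact ⟨σ⟩

lemma exists_extension {X B C Y : A} (hE : E.Ext1Vanishes C Y) {i : X ⟶ B} {d : B ⟶ C}
    (h : E.IsConflation i d) (f : X ⟶ Y) : ∃ g : B ⟶ Y, i ≫ g = f := by
  obtain ⟨P, f', i', d', sq, -, h'⟩ := h.exists_pushout f
  obtain ⟨σ⟩ := hE.nonempty_splitting h'
  exact ⟨f' ≫ σ.r, by simpa [reassoc_of% sq.w] using f ≫= σ.f_r⟩

lemma exists_lift {K B C X : A} (hE : E.Ext1Vanishes X K) {i : K ⟶ B} {d : B ⟶ C}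
    (h : E.IsConflation i d) (f : X ⟶ C) : ∃ g : X ⟶ B, g ≫ d = f := by
  obtain ⟨P, f', d', i', sq, -, h'⟩ := h.exists_pullback f
  obtain ⟨σ⟩ := hE.nonempty_splitting h'
  exact ⟨σ.s ≫ f', by simpa [sq.w] using σ.s_g =≫ f⟩

/-- After pulling `p` back to `B`, the splitting over `X` given by the top of the square extends
along the pullback of `i`, because the cokernel of the latter is again `C`. -/
lemma hasLiftingProperty {X B C K Z W : A} (hE : E.Ext1Vanishes C K) {i : X ⟶ B} {d : B ⟶ C}
    (hi : E.IsConflation i d) {k : K ⟶ Z} {p : Z ⟶ W} (hp : E.IsConflation k p) :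
    HasLiftingProperty i p := by
  refine ⟨fun {u v} sq => ?_⟩
  obtain ⟨P, v', p', k', sqP, -, hp'⟩ := hp.exists_pullback v
  obtain ⟨j, hju, hji⟩ := sqP.exists_lift u i sq.w
  obtain ⟨Q, a, b, k'', sqQ, hk'', hb⟩ := hp'.exists_pullback i
  obtain ⟨s, hsj, hs⟩ := sqQ.exists_lift j (𝟙 X) (by simp [hji])
  obtain ⟨σ, hσ⟩ := hb.exists_splitting_of_section hs
  obtain ⟨r, hr⟩ := hE.exists_extension (hi.comp_deflation sqQ hp'.isDeflationOf) σ.r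
  have hkr : k' ≫ r = 𝟙 K := by simpa [← hk'', hr] using σ.f_r
  have hjr : j ≫ r = 0 := by simpa [← hsj, hr, hσ] using σ.s_r
  obtain ⟨τ, hτ⟩ := hp'.exists_splitting_of_retraction hkr
  have hjs : i ≫ τ.s = j := by
    simpa [hτ, reassoc_of% hjr, reassoc_of% hji] using j ≫= τ.id
  exact ⟨⟨⟨τ.s ≫ v', by rw [reassoc_of% hjs, hju],
    by simpa [sqP.w] using τ.s_g =≫ v⟩⟩⟩

end Ext1Vanishes

lemma IsConflation.llp_deflationsWithKernel_iff {X B C : A} {i : X ⟶ B} {d : B ⟶ C}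
    (h : E.IsConflation i d) {𝒴 : ObjectProperty A} :
    (E.deflationsWithKernel 𝒴).llp i ↔ ∀ Y, 𝒴 Y → E.Ext1Vanishes C Y := by
  refine ⟨fun hi Y hY => ext1Vanishes_of_section fun M j p hp => ?_, fun hC Z W p hp => ?_⟩
  · have := hi p (deflationsWithKernel_iff.2 ⟨_, _, hp, hY⟩)
    have sq : CommSq (0 : X ⟶ M) i p d := ⟨by simp [h.w]⟩
    obtain ⟨s, hs⟩ := h.exists_desc sq.lift sq.fac_left
    have := h.epi
    exact ⟨s, by rw [← cancel_epi d, reassoc_of% hs, sq.fac_right, Category.comp_id]⟩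
  · obtain ⟨K, k, hk, hK⟩ := deflationsWithKernel_iff.1 hp
    exact (hC K hK).hasLiftingProperty h hk

lemma IsConflation.rlp_inflationsWithCokernel_iff {K Z W : A} {k : K ⟶ Z} {p : Z ⟶ W}
    (h : E.IsConflation k p) {𝒳 : ObjectProperty A} :
    (E.inflationsWithCokernel 𝒳).rlp p ↔ ∀ X, 𝒳 X → E.Ext1Vanishes X K := by
  refine ⟨fun hp X hX => ext1Vanishes_of_section fun M i d hi => ?_, fun hK X B i hi => ?_⟩
  · have := hp i (inflationsWithCokernel_iff.2 ⟨_, _, hi, hX⟩)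
    have sq : CommSq k i p (0 : M ⟶ W) := ⟨by simp [h.w]⟩
    obtain ⟨r, hr⟩ := h.exists_lift sq.lift sq.fac_right
    have := h.mono
    obtain ⟨σ, -⟩ := hi.exists_splitting_of_retraction (r := r)
      (by rw [← cancel_mono k, Category.assoc, hr, sq.fac_left, Category.id_comp])
    exact ⟨σ.s, σ.s_g⟩
  · obtain ⟨C, d, hd, hC⟩ := inflationsWithCokernel_iff.1 hi
    exact (hK C hC).hasLiftingProperty hd h

/-! ### Cotorsion pairs -/

namespace IsCotorsionPair

variable {𝒳 𝒴 : ObjectProperty A} (h : E.IsCotorsionPair 𝒳 𝒴)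

include h

lemma ext1Vanishes {X Y : A} (hX : 𝒳 X) (hY : 𝒴 Y) : E.Ext1Vanishes X Y := (h.1 X).1 hX Y hY

lemma left_iff_llp {X B C : A} {i : X ⟶ B} {d : B ⟶ C} (hi : E.IsConflation i d) :
    𝒳 C ↔ (E.deflationsWithKernel 𝒴).llp i :=
  (h.1 C).trans hi.llp_deflationsWithKernel_iff.symm

lemma right_iff_rlp {K Z W : A} {k : K ⟶ Z} {p : Z ⟶ W} (hp : E.IsConflation k p) :
    𝒴 K ↔ (E.inflationsWithCokernel 𝒳).rlp p :=
  (h.2 K).trans hp.rlp_inflationsWithCokernel_iff.symm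

lemma inflationsWithCokernel_le_llp :
    E.inflationsWithCokernel 𝒳 ≤ (E.deflationsWithKernel 𝒴).llp := fun _ _ _ hi =>
  let ⟨_, _, hd, hC⟩ := inflationsWithCokernel_iff.1 hi
  (h.left_iff_llp hd).1 hC

lemma left_isStableUnderRetracts : 𝒳.IsStableUnderRetracts where
  of_retract {X X'} r hX' := by
    refine (h.left_iff_llp (E.isConflation_zero_id X)).2 (MorphismProperty.of_retract ?_
      ((h.left_iff_llp (E.isConflation_zero_id X')).1 hX'))
    exact { i := Arrow.homMk (𝟙 0) r.i, r := Arrow.homMk (𝟙 0) r.r }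

lemma right_isStableUnderRetracts : 𝒴.IsStableUnderRetracts where
  of_retract {Y Y'} r hY' := by
    refine (h.right_iff_rlp (E.isConflation_id_zero Y)).2 (MorphismProperty.of_retract ?_
      ((h.right_iff_rlp (E.isConflation_id_zero Y')).1 hY'))
    exact { i := Arrow.homMk r.i (𝟙 0), r := Arrow.homMk r.r (𝟙 0) }

lemma left_zero : 𝒳 (0 : A) :=
  (h.left_iff_llp (E.isConflation_id_zero 0)).2 (MorphismProperty.id_mem _ _)

lemma right_zero : 𝒴 (0 : A) :=
  (h.right_iff_rlp (E.isConflation_zero_id 0)).2 (MorphismProperty.id_mem _ _)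

lemma inflationsWithCokernel_comp {X Y Z : A} {i : X ⟶ Y} {j : Y ⟶ Z}
    (hi : E.inflationsWithCokernel 𝒳 i) (hj : E.inflationsWithCokernel 𝒳 j) :
    E.inflationsWithCokernel 𝒳 (i ≫ j) := by
  obtain ⟨C, d, hd, -⟩ := inflationsWithCokernel_iff.1 hi
  obtain ⟨C', d', hd', -⟩ := inflationsWithCokernel_iff.1 hj
  obtain ⟨V, e, he⟩ := hd.exists_comp hd'
  exact inflationsWithCokernel_iff.2 ⟨V, e, he, (h.left_iff_llp he).2 (MorphismProperty.comp_mem _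
    _ _ (h.inflationsWithCokernel_le_llp _ hi) (h.inflationsWithCokernel_le_llp _ hj))⟩

lemma left_of_extension {X₁ X₂ X₃ : A} {i : X₁ ⟶ X₂} {d : X₂ ⟶ X₃} (hi : E.IsConflation i d)
    (h₁ : 𝒳 X₁) (h₃ : 𝒳 X₃) : 𝒳 X₂ := by
  refine (h.left_iff_llp (E.isConflation_zero_id X₂)).2 ?_
  rw [← zero_comp (f := i)]
  exact MorphismProperty.comp_mem _ _ _ ((h.left_iff_llp (E.isConflation_zero_id X₁)).1 h₁)
    ((h.left_iff_llp hi).1 h₃)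

lemma right_of_extension {Y₁ Y₂ Y₃ : A} {i : Y₁ ⟶ Y₂} {d : Y₂ ⟶ Y₃} (hi : E.IsConflation i d)
    (h₁ : 𝒴 Y₁) (h₃ : 𝒴 Y₃) : 𝒴 Y₂ := by
  refine (h.right_iff_rlp (E.isConflation_id_zero Y₂)).2 ?_
  rw [← comp_zero (f := d)]
  exact MorphismProperty.comp_mem _ _ _ ((h.right_iff_rlp hi).1 h₁)
    ((h.right_iff_rlp (E.isConflation_id_zero Y₃)).1 h₃)

lemma core_biprod {X Y : A} (hX : (𝒳 ⊓ 𝒴) X) (hY : (𝒳 ⊓ 𝒴) Y) : (𝒳 ⊓ 𝒴) (X ⊞ Y) :=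
  ⟨h.left_of_extension (E.isConflation_inl_snd X Y) hX.1 hY.1,
    h.right_of_extension (E.isConflation_inl_snd X Y) hX.2 hY.2⟩

lemma hasFactorization (hc : E.IsCompletePair 𝒳 𝒴) :
    (E.inflationsWithCokernel 𝒳).HasFactorization (E.deflationsWithKernel 𝒴) where
  nonempty_mapFactorizationData {X B} f := by
    obtain ⟨⟨Y, P, j, d, w, -, hP, hd⟩, -⟩ := hc B
    obtain ⟨K, k, hk⟩ := isDeflationOf_iff.1
      (isDeflationOf_desc (IsConflation.isDeflationOf (i := j) ⟨w, hd⟩) f)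
    obtain ⟨-, Y', X', a, b, w', hY', hX', hab⟩ := hc K
    obtain ⟨Z, a', k', p, sq, hp, hkp⟩ := hk.exists_pushout a
    obtain ⟨b', -, hb'⟩ := IsConflation.of_isPushout (i := a) (d := b) ⟨w', hab⟩ sq.flip
    exact ⟨{ Z := Z, i := biprod.inr ≫ a', p := p, fac := by simp [hp]
             hi := h.inflationsWithCokernel_comp
               (inflationsWithCokernel_iff.2 ⟨P, _, E.isConflation_inr_fst P X, hP⟩)
               (inflationsWithCokernel_iff.2 ⟨X', b', hb', hX'⟩)
             hp := deflationsWithKernel_iff.2 ⟨Y', k', hkp, hY'⟩ }⟩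

lemma isWeakFactorizationSystem (hA : WeaklyIdempotentComplete A) (hc : E.IsCompletePair 𝒳 𝒴) :
    (E.inflationsWithCokernel 𝒳).IsWeakFactorizationSystem (E.deflationsWithKernel 𝒴) := by
  have := h.left_isStableUnderRetracts
  have := h.right_isStableUnderRetracts
  have := inflationsWithCokernel_isStableUnderRetracts (E := E) hA 𝒳
  have := deflationsWithKernel_isStableUnderRetracts (E := E) hA 𝒴
  have := h.hasFactorization hc
  exact .mk' _ _ fun i p hi hp => h.inflationsWithCokernel_le_llp i hi p hp

/-- An extension `M` of `X` by `Y₃` splits: for an approximation `P ⟶ M` by an object of `𝒳`, the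
kernel `N` of `P ⟶ M ⟶ X` lies in `𝒳`, so `N ⟶ Y₃` lifts to `Y₂` and then extends to `P`. -/
lemma right_of_left_hereditary (hc : E.IsCompletePair 𝒳 𝒴)
    (hX : ∀ S, E.conflation S → 𝒳 S.X₂ → 𝒳 S.X₃ → 𝒳 S.X₁) {Y₁ Y₂ Y₃ : A} {i : Y₁ ⟶ Y₂}
    {d : Y₂ ⟶ Y₃} (hi : E.IsConflation i d) (h₁ : 𝒴 Y₁) (h₂ : 𝒴 Y₂) : 𝒴 Y₃ := by
  refine (h.2 _).2 fun X hXX => ext1Vanishes_of_section fun M j e he => ?_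
  obtain ⟨⟨Y, P, k, p, w, -, hP, hp⟩, -⟩ := hc M
  have hp : E.IsConflation k p := ⟨w, hp⟩
  obtain ⟨N, j', p', k', sq, hk', hp'⟩ := hp.exists_pullback j
  have hj' := he.comp_deflation sq hp.isDeflationOf
  have hN : 𝒳 N := hX _ hj'.2 hP hXX
  obtain ⟨a, ha⟩ := (h.ext1Vanishes hN h₁).exists_lift hi p'
  obtain ⟨b, hb⟩ := (h.ext1Vanishes hXX h₂).exists_extension hj' a
  obtain ⟨r, hr⟩ := hp.exists_desc (b ≫ d)
    (by rw [← hk', Category.assoc, reassoc_of% hb, ha, hp'.w])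
  have := hp'.epi
  obtain ⟨σ, -⟩ := he.exists_splitting_of_retraction (r := r)
    (by rw [← cancel_epi p', ← reassoc_of% sq.w, hr, reassoc_of% hb, ha, Category.comp_id])
  exact ⟨σ.s, σ.s_g⟩

end IsCotorsionPair

/-! ### From cotorsion pairs to model structures -/

lemma splitEpisWithKernel_le_deflationsWithKernel {ω 𝒴 : ObjectProperty A} (h : ω ≤ 𝒴) :
    splitEpisWithKernel ω ≤ E.deflationsWithKernel 𝒴 := by
  rintro Z B p ⟨K, k, w, ⟨σ⟩, hK⟩
  exact deflationsWithKernel_iff.2 ⟨K, k, .of_splitting σ, h K hK⟩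

lemma dualOmega_cofib (P : ObjectProperty A × ObjectProperty A) :
    (E.dualOmega P).cofib = (splitEpisWithKernel (P.1 ⊓ P.2)).llp := by
  ext X Y f
  exact (forall_congr' fun _ => and_imp.symm).trans llp_splitEpisWithKernel_iff.symm

lemma dualOmega_weq_iff {P : ObjectProperty A × ObjectProperty A} {B C : A} {f : B ⟶ C} :
    (E.dualOmega P).weq f ↔ ∃ (Z : A) (i : B ⟶ Z) (p : Z ⟶ C),
      E.inflationsWithCokernel P.1 i ∧ splitEpisWithKernel (P.1 ⊓ P.2) p ∧ i ≫ p = f := by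
  constructor
  · rintro ⟨W, t, hW, hi⟩
    exact ⟨_, _, biprod.fst, hi, splitEpisWithKernel_biprod_fst C hW, biprod.lift_fst f t⟩
  · rintro ⟨Z, i, p, hi, ⟨K, k, w, ⟨σ⟩, hK⟩, rfl⟩
    obtain ⟨X, d, hd, hX⟩ := inflationsWithCokernel_iff.1 hi
    let e : Z ≅ C ⊞ K := σ.isoBinaryBiproduct ≪≫ biprod.braiding K C
    exact ⟨K, i ≫ σ.r, hK, inflationsWithCokernel_iff.2 ⟨X, e.inv ≫ d,
      hd.of_iso (Iso.refl _) e (Iso.refl _) (by ext <;> simp [e]) (by simp), hX⟩⟩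

namespace IsCotorsionPair

variable {𝒳 𝒴 : ObjectProperty A} (h : E.IsCotorsionPair 𝒳 𝒴)

include h

lemma stableRel_congruence : Congruence (stableRel (𝒳 ⊓ 𝒴)) :=
  ExactCat.stableRel_congruence ⟨0, h.left_zero, h.right_zero⟩ h.core_biprod

lemma stableRel_zero (hc : E.IsCompletePair 𝒳 𝒴) {X Y : A} (hX : 𝒳 X) (hY : 𝒴 Y) (f : X ⟶ Y) :
    stableRel (𝒳 ⊓ 𝒴) f 0 := by
  obtain ⟨-, Y', X', i, d, w, hY', hX', hd⟩ := hc X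
  have hd : E.IsConflation i d := ⟨w, hd⟩
  obtain ⟨g, hg⟩ := (h.ext1Vanishes hX' hY).exists_extension hd f
  exact ⟨Y', i, g, ⟨h.left_of_extension hd hX hX', hY'⟩, by simp [hg]⟩

lemma inflationsWithCokernel_le_stableEquivalences (hc : E.IsCompletePair 𝒳 𝒴) :
    E.inflationsWithCokernel 𝒳 ≤ stableEquivalences (𝒳 ⊓ 𝒴) 𝒴 := fun B C f hf => by
  have := h.stableRel_congruence
  obtain ⟨X, d, hd, hX⟩ := inflationsWithCokernel_iff.1 hf
  refine stableEquivalences_iff.2 fun Y hY => ⟨?_, fun g => ?_⟩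
  · rintro a a' ⟨W, b, c, hW, hbc⟩
    obtain ⟨l, hl⟩ := (h.ext1Vanishes hX hW.2).exists_extension hd b
    obtain ⟨x, hx⟩ := hd.exists_desc (a - a' - l ≫ c) (by simp [hbc, reassoc_of% hl])
    obtain ⟨W', b', c', hW', hx'⟩ := h.stableRel_zero hc hX hY x
    refine ⟨W ⊞ W', biprod.lift l (d ≫ b'), biprod.desc c c', h.core_biprod hW hW', ?_⟩
    simp [hx', hx]
  · obtain ⟨l, hl⟩ := (h.ext1Vanishes hX hY).exists_extension hd g
    exact ⟨l, hl ▸ Congruence.equivalence.refl _⟩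

/-- A stable inverse of `q` can be corrected to a section of `q`, because morphisms from the core
to `V` lift along `q`. -/
lemma left_and_nonempty_splitting_of_stableEquivalences {K Y V : A} {k : K ⟶ Y} {q : Y ⟶ V}
    (hq : E.IsConflation k q) (hK : 𝒴 K) (hY : 𝒴 Y) (hV : 𝒴 V)
    (hs : stableEquivalences (𝒳 ⊓ 𝒴) 𝒴 q) :
    𝒳 K ∧ Nonempty (ShortComplex.mk k q hq.w).Splitting := by
  have := h.stableRel_congruence
  have := h.left_isStableUnderRetracts
  rw [stableEquivalences_iff] at hs
  obtain ⟨s, hqs⟩ := (hs Y hY).2 (𝟙 Y)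
  obtain ⟨W, a, b, hW, hab⟩ := (hs V hV).1 (s ≫ q) (𝟙 V)
    (by simpa using HomRel.comp_right q hqs)
  obtain ⟨b', hb'⟩ := (h.ext1Vanishes hW.1 hK).exists_lift hq b
  obtain ⟨σ, -⟩ := hq.exists_splitting_of_section (s := s - a ≫ b') (by simp [hb', hab])
  obtain ⟨W', c, d, hW', hcd⟩ := hqs
  refine ⟨𝒳.prop_of_retract ⟨k ≫ c, -(d ≫ σ.r), ?_⟩ hW'.1, ⟨σ⟩⟩
  simpa [reassoc_of% hcd, reassoc_of% hq.w] using σ.f_r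

/-- Embedding the source into an object of `𝒴` reduces to a deflation between objects of `𝒴`, whose
target lies in `𝒴` by heredity. -/
lemma deflationsWithKernel_inf_stableEquivalences (hc : E.IsCompletePair 𝒳 𝒴)
    (hh : E.IsHereditaryPair 𝒳 𝒴) :
    E.deflationsWithKernel 𝒴 ⊓ stableEquivalences (𝒳 ⊓ 𝒴) 𝒴 = splitEpisWithKernel (𝒳 ⊓ 𝒴) := by
  have := h.stableRel_congruence
  refine le_antisymm ?_ (le_inf (splitEpisWithKernel_le_deflationsWithKernel inf_le_right)
    splitEpisWithKernel_le_stableEquivalences)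
  rintro Z B p ⟨hp, hs⟩
  obtain ⟨K, k, hk, hK⟩ := deflationsWithKernel_iff.1 hp
  obtain ⟨-, Y, X, j, e, w, hY, hX, he⟩ := hc Z
  have he : E.IsConflation j e := ⟨w, he⟩
  obtain ⟨V, q, hq⟩ := hk.exists_comp he
  obtain ⟨b, g, hb, -, hbg⟩ := hk.cokernel_comparison he hq
  have hS {M N L : A} {i : M ⟶ N} {d : N ⟶ L} (hi : E.IsConflation i d) (hL : 𝒳 L) :=
    h.inflationsWithCokernel_le_stableEquivalences hc i
      (inflationsWithCokernel_iff.2 ⟨L, d, hi, hL⟩)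
  have hqs : stableEquivalences (𝒳 ⊓ 𝒴) 𝒴 q :=
    MorphismProperty.of_precomp _ j q (hS he hX)
      (hb ▸ MorphismProperty.comp_mem _ _ _ hs (hS hbg hX))
  obtain ⟨hKX, ⟨σ⟩⟩ := h.left_and_nonempty_splitting_of_stableEquivalences hq hK hY
    (hh.2 _ hq.2 hK hY) hqs
  obtain ⟨τ, -⟩ := hk.exists_splitting_of_retraction (r := j ≫ σ.r) (by simpa using σ.f_r)
  exact ⟨K, k, hk.w, ⟨τ⟩, hKX, hK⟩

lemma dualOmega_weq (hc : E.IsCompletePair 𝒳 𝒴) (hh : E.IsHereditaryPair 𝒳 𝒴) :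
    (E.dualOmega (𝒳, 𝒴)).weq = stableEquivalences (𝒳 ⊓ 𝒴) 𝒴 := by
  have := h.stableRel_congruence
  have hi := h.inflationsWithCokernel_le_stableEquivalences hc
  ext B C f
  rw [dualOmega_weq_iff]
  constructor
  · rintro ⟨Z, i, p, hi', hp, rfl⟩
    exact MorphismProperty.comp_mem _ _ _ (hi i hi')
      (splitEpisWithKernel_le_stableEquivalences p hp)
  · intro hf
    have := h.hasFactorization hc
    let d := MorphismProperty.factorizationData (E.inflationsWithCokernel 𝒳)
      (E.deflationsWithKernel 𝒴) f
    refine ⟨_, d.i, d.p, d.hi, ?_, d.fac⟩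
    rw [← h.deflationsWithKernel_inf_stableEquivalences hc hh]
    exact ⟨d.hp, MorphismProperty.of_precomp _ d.i d.p (hi d.i d.hi) (by rwa [d.fac])⟩

lemma llp_splitEpisWithKernel_inf_stableEquivalences (hA : WeaklyIdempotentComplete A)
    (hc : E.IsCompletePair 𝒳 𝒴) (hh : E.IsHereditaryPair 𝒳 𝒴) :
    (splitEpisWithKernel (𝒳 ⊓ 𝒴)).llp ⊓ stableEquivalences (𝒳 ⊓ 𝒴) 𝒴 =
      E.inflationsWithCokernel 𝒳 := by
  have hi := h.inflationsWithCokernel_le_stableEquivalences hc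
  have hwfs := h.isWeakFactorizationSystem hA hc
  refine le_antisymm (fun B C f hf => ?_) (le_inf ?_ hi)
  · let d := MorphismProperty.factorizationData (E.inflationsWithCokernel 𝒳)
      (E.deflationsWithKernel 𝒴) f
    have hp : (E.deflationsWithKernel 𝒴 ⊓ stableEquivalences (𝒳 ⊓ 𝒴) 𝒴) d.p :=
      ⟨d.hp, MorphismProperty.of_precomp _ d.i d.p (hi d.i d.hi) (d.fac.symm ▸ hf.2)⟩
    rw [h.deflationsWithKernel_inf_stableEquivalences hc hh] at hp
    have := hf.1 d.p hp
    have := h.left_isStableUnderRetracts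
    have := inflationsWithCokernel_isStableUnderRetracts (E := E) hA 𝒳
    exact MorphismProperty.of_retract (RetractArrow.ofLeftLiftingProperty d.fac) d.hi
  · rw [← hwfs.llp]
    exact MorphismProperty.antitone_llp (splitEpisWithKernel_le_deflationsWithKernel inf_le_right)

lemma isWeakFactorizationSystem_llp_splitEpisWithKernel (hA : WeaklyIdempotentComplete A)
    (hc : E.IsCompletePair 𝒳 𝒴) (hh : E.IsHereditaryPair 𝒳 𝒴) (hω : CovariantlyFinite (𝒳 ⊓ 𝒴)) :
    (splitEpisWithKernel (𝒳 ⊓ 𝒴)).llp.IsWeakFactorizationSystem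
      (splitEpisWithKernel (𝒳 ⊓ 𝒴)) := by
  have := h.right_isStableUnderRetracts
  have := deflationsWithKernel_isStableUnderRetracts (E := E) hA 𝒴
  have : (splitEpisWithKernel (𝒳 ⊓ 𝒴)).IsStableUnderRetracts :=
    h.deflationsWithKernel_inf_stableEquivalences hc hh ▸ inferInstance
  have : (splitEpisWithKernel (𝒳 ⊓ 𝒴)).llp.HasFactorization (splitEpisWithKernel (𝒳 ⊓ 𝒴)) := by
    refine ⟨fun {B C} f => ?_⟩
    obtain ⟨W, w, hW, hw⟩ := hω B
    refine ⟨⟨C ⊞ W, biprod.lift f w, biprod.fst, by simp, ?_, splitEpisWithKernel_biprod_fst C hW⟩⟩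
    refine llp_splitEpisWithKernel_iff.2 fun W' hW' g => ?_
    obtain ⟨l, hl⟩ := hw g hW'
    exact ⟨biprod.snd ≫ l, by simp [hl]⟩
  exact .mk' _ _ fun i p hi hp => hi p hp

end IsCotorsionPair

lemma dualOmega_cofib_inf_weq (hA : WeaklyIdempotentComplete A)
    {P : ObjectProperty A × ObjectProperty A} (hP : P ∈ E.cotorsionPairs) :
    (E.dualOmega P).cofib ⊓ (E.dualOmega P).weq = E.inflationsWithCokernel P.1 := by
  obtain ⟨h, hc, hh, -⟩ := hP
  rw [dualOmega_cofib, h.dualOmega_weq hc hh,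
    h.llp_splitEpisWithKernel_inf_stableEquivalences hA hc hh]

lemma dualOmega_fib_inf_weq {P : ObjectProperty A × ObjectProperty A}
    (hP : P ∈ E.cotorsionPairs) :
    (E.dualOmega P).fib ⊓ (E.dualOmega P).weq = splitEpisWithKernel (P.1 ⊓ P.2) := by
  obtain ⟨h, hc, hh, -⟩ := hP
  rw [h.dualOmega_weq hc hh]
  exact h.deflationsWithKernel_inf_stableEquivalences hc hh

lemma isModelStructure_dualOmega (hA : WeaklyIdempotentComplete A)
    {P : ObjectProperty A × ObjectProperty A} (hP : P ∈ E.cotorsionPairs) :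
    (E.dualOmega P).IsModelStructure := by
  obtain ⟨h, hc, hh, hω⟩ := id hP
  have hw := h.dualOmega_weq hc hh
  have : (E.dualOmega P).weq.HasTwoOutOfThreeProperty := hw ▸ inferInstance
  have : (E.dualOmega P).weq.IsStableUnderRetracts := hw ▸ inferInstance
  have : ((E.dualOmega P).cofib ⊓ (E.dualOmega P).weq).IsWeakFactorizationSystem
      (E.dualOmega P).fib := dualOmega_cofib_inf_weq hA hP ▸ h.isWeakFactorizationSystem hA hc
  have : (E.dualOmega P).cofib.IsWeakFactorizationSystem
      ((E.dualOmega P).fib ⊓ (E.dualOmega P).weq) := by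
    rw [dualOmega_cofib, dualOmega_fib_inf_weq hP]
    exact h.isWeakFactorizationSystem_llp_splitEpisWithKernel hA hc hh hω
  exact MorphismTriple.isModelStructure_of_isWeakFactorizationSystem

lemma objectPair_dualOmega (hA : WeaklyIdempotentComplete A)
    {P : ObjectProperty A × ObjectProperty A} (hP : P ∈ E.cotorsionPairs) :
    (E.dualOmega P).objectPair = P := by
  have hwfs := hP.1.isWeakFactorizationSystem hA hP.2.1
  refine Prod.ext (funext fun X => propext ?_) (funext fun X => propext ?_)
  · rw [hP.1.left_iff_llp (E.isConflation_zero_id X), hwfs.llp, ← dualOmega_cofib_inf_weq hA hP]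
    rfl
  · rw [hP.1.right_iff_rlp (E.isConflation_id_zero X), hwfs.rlp]
    rfl

lemma dualOmega_mem_weaklyInjectiveModelStructures (hA : WeaklyIdempotentComplete A)
    {P : ObjectProperty A × ObjectProperty A} (hP : P ∈ E.cotorsionPairs) :
    E.dualOmega P ∈ E.weaklyInjectiveModelStructures := by
  have hY : (E.dualOmega P).fibrant = P.2 := congrArg Prod.snd (objectPair_dualOmega hA hP)
  refine ⟨isModelStructure_dualOmega hA hP, by rw [hY]; rfl, fun X Y f hf hw => ?_,
    fun X W _ _ g => ⟨0, (isZero_zero A).eq_of_src _ _⟩⟩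
  obtain ⟨C, d, hd, -⟩ := inflationsWithCokernel_iff.1
    ((dualOmega_cofib_inf_weq hA hP).le f ⟨hf, hw⟩)
  exact hd.isInflationOf

/-! ### From weakly injective model structures to cotorsion pairs -/

section WeaklyInjective

variable {M : MorphismTriple A} (hM : M ∈ E.weaklyInjectiveModelStructures)

include hM

lemma triviallyCofibrant_iff_of_weaklyInjective (X : A) :
    M.triviallyCofibrant X ↔ ∀ Y, M.fibrant Y → E.Ext1Vanishes X Y := by
  rw [← (E.isConflation_zero_id X).llp_deflationsWithKernel_iff, ← hM.2.1, hM.1.llp_fib]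
  rfl

lemma trivial_cofib_eq_of_weaklyInjective :
    M.cofib ⊓ M.weq = E.inflationsWithCokernel M.triviallyCofibrant := by
  ext X Y f
  have hf {C : A} {d : Y ⟶ C} (hd : E.IsConflation f d) :
      (M.cofib ⊓ M.weq) f ↔ M.triviallyCofibrant C := by
    rw [← hM.1.llp_fib, hM.2.1, hd.llp_deflationsWithKernel_iff,
      triviallyCofibrant_iff_of_weaklyInjective hM]
  constructor
  · intro hi
    obtain ⟨C, d, hd⟩ := isInflationOf_iff.1 (hM.2.2.1 f hi.1 hi.2)
    exact inflationsWithCokernel_iff.2 ⟨C, d, hd, (hf hd).1 hi⟩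
  · intro hi
    obtain ⟨C, d, hd, hC⟩ := inflationsWithCokernel_iff.1 hi
    exact (hf hd).2 hC

lemma isCotorsionPair_of_weaklyInjective :
    E.IsCotorsionPair M.triviallyCofibrant M.fibrant := by
  refine ⟨triviallyCofibrant_iff_of_weaklyInjective hM, fun Y => ?_⟩
  rw [← (E.isConflation_id_zero Y).rlp_inflationsWithCokernel_iff,
    ← trivial_cofib_eq_of_weaklyInjective hM, hM.1.rlp_trivial_cofib]
  rfl

lemma isCompletePair_of_weaklyInjective : E.IsCompletePair M.triviallyCofibrant M.fibrant := by
  refine fun X => ⟨?_, ?_⟩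
  · obtain ⟨Z, i, p, hi, hw, hp, -⟩ := hM.1.factor_trivial_cofib (0 : 0 ⟶ X)
    rw [hM.2.1] at hp
    obtain ⟨K, k, hk, hK⟩ := deflationsWithKernel_iff.1 hp
    obtain rfl : i = 0 := (isZero_zero A).eq_of_src i 0
    exact ⟨K, Z, k, p, hk.1, hK, ⟨hi, hw⟩, hk.2⟩
  · obtain ⟨Z, i, p, hi, hw, hp, -⟩ := hM.1.factor_trivial_cofib (0 : X ⟶ 0)
    obtain ⟨C, d, hd, hC⟩ := inflationsWithCokernel_iff.1
      ((trivial_cofib_eq_of_weaklyInjective hM).le i ⟨hi, hw⟩)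
    obtain rfl : p = 0 := (isZero_zero A).eq_of_tgt p 0
    exact ⟨Z, C, i, d, hd.1, hp, hC, hd.2⟩

lemma isHereditaryPair_of_weaklyInjective :
    E.IsHereditaryPair M.triviallyCofibrant M.fibrant := by
  have h (S) (hS : E.conflation S) (h₂ : M.triviallyCofibrant S.X₂)
      (h₃ : M.triviallyCofibrant S.X₃) : M.triviallyCofibrant S.X₁ := by
    have := hM.1.two_out_of_three
    have hf := (trivial_cofib_eq_of_weaklyInjective hM).ge S.f ⟨S.X₃, S.g, S.zero, hS, h₃⟩
    exact ⟨hM.2.2.2 _, M.weq.of_postcomp _ S.f hf.2 (by rw [zero_comp]; exact h₂.2)⟩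
  exact ⟨h, fun S hS h₁ h₂ => (isCotorsionPair_of_weaklyInjective hM).right_of_left_hereditary
    (isCompletePair_of_weaklyInjective hM) h ⟨S.zero, hS⟩ h₁ h₂⟩

lemma trivial_fib_to_zero_iff_of_weaklyInjective (X : A) :
    (M.fib ⊓ M.weq) (0 : X ⟶ 0) ↔ (M.triviallyCofibrant ⊓ M.fibrant) X :=
  (and_congr_right fun _ => hM.1.weq_to_zero_iff X).trans
    ⟨fun h => ⟨⟨hM.2.2.2 X, h.2⟩, h.1⟩, fun h => ⟨h.2, h.1.2⟩⟩

lemma trivial_fib_le_of_weaklyInjective :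
    M.fib ⊓ M.weq ≤ splitEpisWithKernel (M.triviallyCofibrant ⊓ M.fibrant) := fun Z B p hp => by
  obtain ⟨K, k, hk, -⟩ := deflationsWithKernel_iff.1 (hM.2.1.le p hp.1)
  rw [← hM.1.rlp_cofib] at hp
  have := hp (0 : 0 ⟶ B) (hM.2.2.2 B)
  have sq : CommSq (0 : 0 ⟶ Z) 0 p (𝟙 B) := ⟨by simp⟩
  obtain ⟨σ, -⟩ := hk.exists_splitting_of_section sq.fac_right
  refine ⟨K, k, hk.w, ⟨σ⟩, (trivial_fib_to_zero_iff_of_weaklyInjective hM K).1 ?_⟩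
  have r : RetractArrow (0 : K ⟶ 0) p :=
    { i := Arrow.homMk k 0 (by simp [hk.w])
      r := Arrow.homMk σ.r 0
      retract := by ext <;> simp [σ.f_r] }
  rw [← hM.1.rlp_cofib]
  exact MorphismProperty.of_retract r hp

lemma cofib_eq_of_weaklyInjective :
    M.cofib = (splitEpisWithKernel (M.triviallyCofibrant ⊓ M.fibrant)).llp := by
  refine le_antisymm (fun X Y f hf => llp_splitEpisWithKernel_iff.2 fun W hW g => ?_) ?_
  · rw [← hM.1.llp_trivial_fib] at hf
    have := hf (0 : W ⟶ 0) ((trivial_fib_to_zero_iff_of_weaklyInjective hM W).2 hW)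
    have sq : CommSq g f (0 : W ⟶ 0) 0 := ⟨by simp⟩
    exact ⟨sq.lift, sq.fac_left⟩
  · rw [← hM.1.llp_trivial_fib]
    exact MorphismProperty.antitone_llp (trivial_fib_le_of_weaklyInjective hM)

lemma covariantlyFinite_of_weaklyInjective :
    CovariantlyFinite (M.triviallyCofibrant ⊓ M.fibrant) := fun X => by
  obtain ⟨W, j, q, hj, hq, hw, -⟩ := hM.1.factor_trivial_fib (0 : X ⟶ 0)
  obtain rfl : q = 0 := (isZero_zero A).eq_of_tgt q 0
  rw [cofib_eq_of_weaklyInjective hM] at hj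
  exact ⟨W, j, (trivial_fib_to_zero_iff_of_weaklyInjective hM W).1 ⟨hq, hw⟩,
    fun W' g hW' => llp_splitEpisWithKernel_iff.1 hj W' hW' g⟩

lemma objectPair_mem_cotorsionPairs : M.objectPair ∈ E.cotorsionPairs :=
  ⟨isCotorsionPair_of_weaklyInjective hM, isCompletePair_of_weaklyInjective hM,
    isHereditaryPair_of_weaklyInjective hM, covariantlyFinite_of_weaklyInjective hM⟩

lemma dualOmega_objectPair (hA : WeaklyIdempotentComplete A) : E.dualOmega M.objectPair = M :=
  (isModelStructure_dualOmega hA (objectPair_mem_cotorsionPairs hM)).ext hM.1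
    ((dualOmega_cofib _).trans (cofib_eq_of_weaklyInjective hM).symm) hM.2.1.symm

end WeaklyInjective

end ExactStructure

end ExactCat

theorem theorem5p7 {A : Type u} [Category.{v} A] [Preadditive A] [HasZeroObject A]
    [HasBinaryBiproducts A] (E : ExactCat.ExactStructure A)
    (hA : ExactCat.WeaklyIdempotentComplete A) :
    Set.BijOn E.dualOmega E.cotorsionPairs E.weaklyInjectiveModelStructures ∧
    Set.BijOn (fun M => M.objectPair)
      E.weaklyInjectiveModelStructures E.cotorsionPairs ∧
    Set.InvOn (fun M => M.objectPair) (fun P => E.dualOmega P)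
      E.cotorsionPairs E.weaklyInjectiveModelStructures := by
  have hinv : Set.InvOn (fun M => M.objectPair) (fun P => E.dualOmega P)
      E.cotorsionPairs E.weaklyInjectiveModelStructures :=
    ⟨fun _ hP => ExactCat.ExactStructure.objectPair_dualOmega hA hP,
      fun _ hM => ExactCat.ExactStructure.dualOmega_objectPair hM hA⟩
  have h₁ : Set.MapsTo E.dualOmega E.cotorsionPairs E.weaklyInjectiveModelStructures :=
    fun _ hP => ExactCat.ExactStructure.dualOmega_mem_weaklyInjectiveModelStructures hA hP
  have h₂ : Set.MapsTo (fun M : ExactCat.MorphismTriple A => M.objectPair)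
      E.weaklyInjectiveModelStructures E.cotorsionPairs :=
    fun _ hM => ExactCat.ExactStructure.objectPair_mem_cotorsionPairs hM
  exact ⟨hinv.bijOn h₁ h₂, hinv.symm.bijOn h₂ h₁, hinv⟩
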